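/- Let $(I,\mathcal A,\mu)$ be a probability space, write $|A|=\mu(A)$, and let $(\mathcal P^k)_{k\ge 0}$ be a good grid: finite measurable partitions of $I$ (up to null sets) that generate $\mathcal A$, with $\mathcal P^0=\{I\}$, every $Q\in\mathcal P^{k+1}$ contained in some $P\in\mathcal P^k$ (then $Q$ is called a child of $P$), and $\lambda_*\le |Q|/|P|\le\lambda$ for some constants $\lambda_*,\lambda\in(0,1)$ and all children $Q$ of $P$. Fix a total order on the set of children of every cell $Q$, and let $\mathcal H_Q$ be the set of pairs $(S_1,S_2)$ of blocks of children of $Q$ obtained by halving the ordered list of all children of $Q$ and then, repeatedly, every half with at least two elements (a block with $n\ge 2$ elements is halved into its first $\lfloor n/2\rfloor$ elements and the rest). A block is identified with the union of its cells, and $|S_i|$ denotes the sum of the measures of its cells. Let $$\phi_{(S_1,S_2)}=\frac{\sum_{P\in S_1}1_P}{|S_1|}-\frac{\sum_{P\in S_2}1_P}{|S_2|}$$ be the unbalanced Haar wavelets. Let $s>0$. The space $B^s_{\infty,\infty}$ consists of all $\psi\in L^\infty(I)$ of the form $\psi=c_I1_I+\sum_k\sum_{Q\in\mathcal P^k}\sum_{p\in\mathcal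 H_Q}|Q|^{1+s}c_p\phi_p$ with complex coefficients and norm $|\psi|_{B^s_{\infty,\infty}}=|c_I|+\sup_p|c_p|<\infty$. The space $B^{-s}_{1,1}$ consists of all continuous linear functionals $\varphi$ on $B^s_{\infty,\infty}$ of the form $\varphi(\psi)=d_I\int\psi\,d\mu+\sum_k\sum_{Q\in\mathcal P^k}\sum_{p\in\mathcal H_Q}d_p|Q|^{-s}\int\psi\phi_p\,d\mu$ with norm $|\varphi|_{B^{-s}_{1,1}}=|d_I|+\sum_p|d_p|<\infty$. Let $\hat I$ be the set of sequences $x=(Q_0,Q_1,\dots)$ with $Q_0=I$ and $Q_{j+1}$ a child of $Q_j$. Say that $x\in A$ if some $Q_j$ is contained in $A$ up to a null set, and let $\delta_x=\lim_{j}1_{Q_j}/|Q_j|$, the limit being taken in $B^{-s}_{1,1}$, where $1_{Q_j}$ acts on $\psi$ by $\int_{Q_j}\psi\,d\mu$. A dipole is a difference $\delta_x-\delta_y$ with $x\ne y$. Let $\mathcal F$ be the family consisting of $I$ and of all the sets $P_1,P_2$ with $(P_1,P_2)\in\mathcal H_Q$, $Q\in\bigcup_k\mathcal P^k$. For every $P\in\mathcal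 F$ choose a point $x_P\in\hat I$ such that (A) $x_P\in P$, and (B) $x_P=x_Q$ whenever $P,Q\in\mathcal F$, $P\subset Q$ and $x_Q\in P$. The dipole basis associated with this choice is the family consisting of $\delta_{x_I}$ and of $\delta_{x_{P_1}}-\delta_{x_{P_2}}$ for all $Q\in\bigcup_k\mathcal P^k$ and all $(P_1,P_2)\in\mathcal H_Q$. Theorem. The limits $\delta_x$ exist for all $x\in\hat I$, and choices $(x_P)_{P\in\mathcal F}$ with (A) and (B) exist. For every such choice $x_{P_1}\neq x_{P_2}$ for all $(P_1,P_2)$, so that the associated dipole basis consists of a single Dirac mass and of dipoles, and the dipole basis is an unconditional Schauder basis of $B^{-s}_{1,1}$. In particular $B^{-s}_{1,1}$ has an unconditional Schauder basis that contains only dipoles and a single Dirac mass. -/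

import Mathlib

open MeasureTheory Filter Topology Set
open scoped ENNReal

noncomputable section

/-- A good grid on a measure space: finite measurable partitions (up to null sets) `cells 0`,
`cells 1`, ..., each refining the previous one (up to null sets), such that the measure of a child
is comparable to the measure of its father, and that generate the σ-algebra (up to null sets). -/
structure GoodGrid {Ω : Type*} [MeasurableSpace Ω] (μ : Measure Ω) where
  cells : ℕ → Finset (Set Ω)
  measurable_cell : ∀ k, ∀ Q ∈ cells k, MeasurableSet Q
  disjoint_cell : ∀ k, ∀ Q ∈ cells k, ∀ R ∈ cells k, Q ≠ R → μ (Q ∩ R) = 0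
  cover : ∀ k, μ (⋃ Q ∈ cells k, Q)ᶜ = 0
  cells_zero : cells 0 = {univ}
  nested : ∀ k, ∀ Q ∈ cells (k + 1), ∃ P ∈ cells k, Q ≤ᵐ[μ] P
  ratio : ∃ lamStar ∈ Ioo (0 : ℝ) 1, ∃ lam ∈ Ioo (0 : ℝ) 1,
    ∀ k, ∀ P ∈ cells k, ∀ Q ∈ cells (k + 1), Q ≤ᵐ[μ] P →
      lamStar ≤ μ.real Q / μ.real P ∧ μ.real Q / μ.real P ≤ lam
  generates : ∀ A : Set Ω, MeasurableSet A →
    ∃ B : Set Ω, MeasurableSet[MeasurableSpace.generateFrom {Q | ∃ k, Q ∈ cells k}] B ∧ A =ᵐ[μ] B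

/-- A choice of a total order on the set of children of every cell, as a list of the children
without repetitions. -/
structure GoodGrid.ChildOrder {Ω : Type*} [MeasurableSpace Ω] {μ : Measure Ω}
    (G : GoodGrid μ) where
  children : ℕ → Set Ω → List (Set Ω)
  nodup : ∀ k, ∀ Q ∈ G.cells k, (children k Q).Nodup
  mem_children : ∀ k, ∀ Q ∈ G.cells k, ∀ R,
    R ∈ children k Q ↔ R ∈ G.cells (k + 1) ∧ R ≤ᵐ[μ] Q

/-- `IsHaarPair l S₁ S₂`: the pair `(S₁, S₂)` is obtained from the ordered block `l` by iterated
halving. A block with `n ≥ 2` elements is halved into its first `⌊n / 2⌋` elements and the rest. -/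
inductive IsHaarPair {α : Type*} : List α → List α → List α → Prop
  | halve (l : List α) : 2 ≤ l.length →
      IsHaarPair l (l.take (l.length / 2)) (l.drop (l.length / 2))
  | left (l S₁ S₂ : List α) : IsHaarPair (l.take (l.length / 2)) S₁ S₂ → IsHaarPair l S₁ S₂
  | right (l S₁ S₂ : List α) : IsHaarPair (l.drop (l.length / 2)) S₁ S₂ → IsHaarPair l S₁ S₂

theorem IsHaarPair.tree {α : Type*} {l S₁ S₂ : List α} (h : IsHaarPair l S₁ S₂) :
    S₁ ≠ [] ∧ S₂ ≠ [] ∧ (S₁ ++ S₂).Sublist l := by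
  induction h with
  | halve l h =>
    refine ⟨?_, ?_, by simp⟩
    · intro h0
      have := congrArg List.length h0
      rw [List.length_take, List.length_nil] at this
      omega
    · intro h0
      have := congrArg List.length h0
      rw [List.length_drop, List.length_nil] at this
      omega
  | left l S₁ S₂ _ ih => exact ⟨ih.1, ih.2.1, ih.2.2.trans (List.take_sublist _ _)⟩
  | right l S₁ S₂ _ ih => exact ⟨ih.1, ih.2.1, ih.2.2.trans (List.drop_sublist _ _)⟩

/-- Two Haar pairs of the same block are equal, or one of them lies inside a half of the other
one, or they are disjoint. -/
theorem IsHaarPair.dichotomy {α : Type*} {l S₁ S₂ : List α} (h : IsHaarPair l S₁ S₂) :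
    ∀ {T₁ T₂ : List α}, l.Nodup → IsHaarPair l T₁ T₂ →
      (S₁ = T₁ ∧ S₂ = T₂) ∨ (T₁ ++ T₂ ⊆ S₁) ∨ (T₁ ++ T₂ ⊆ S₂) ∨ (S₁ ++ S₂ ⊆ T₁) ∨
        (S₁ ++ S₂ ⊆ T₂) ∨ (S₁ ++ S₂).Disjoint (T₁ ++ T₂) := by
  have key : ∀ {l : List α}, l.Nodup →
      (l.take (l.length / 2)).Disjoint (l.drop (l.length / 2)) := by
    intro l hl
    exact List.disjoint_take_drop hl le_rfl
  induction h with
  | halve l h =>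
    intro T₁ T₂ hl hT
    cases hT with
    | halve _ _ => exact Or.inl ⟨rfl, rfl⟩
    | left _ _ _ hT => exact Or.inr (Or.inl hT.tree.2.2.subset)
    | right _ _ _ hT => exact Or.inr (Or.inr (Or.inl hT.tree.2.2.subset))
  | left l S₁ S₂ hS ih =>
    intro T₁ T₂ hl hT
    cases hT with
    | halve _ _ => exact Or.inr (Or.inr (Or.inr (Or.inl hS.tree.2.2.subset)))
    | left _ _ _ hT => exact ih (hl.sublist (List.take_sublist _ _)) hT
    | right _ _ _ hT =>
      refine Or.inr (Or.inr (Or.inr (Or.inr (Or.inr ?_))))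
      intro a ha hb
      exact key hl (hS.tree.2.2.subset ha) (hT.tree.2.2.subset hb)
  | right l S₁ S₂ hS ih =>
    intro T₁ T₂ hl hT
    cases hT with
    | halve _ _ => exact Or.inr (Or.inr (Or.inr (Or.inr (Or.inl hS.tree.2.2.subset))))
    | right _ _ _ hT => exact ih (hl.sublist (List.drop_sublist _ _)) hT
    | left _ _ _ hT =>
      refine Or.inr (Or.inr (Or.inr (Or.inr (Or.inr ?_))))
      intro a ha hb
      exact key hl (hT.tree.2.2.subset hb) (hS.tree.2.2.subset ha)

/-- The indices of the Haar system: a cell `Q` of level `level` and a pair of consecutive blocks of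
children of `Q` obtained by iterated halving. -/
structure HaarPair {Ω : Type*} [MeasurableSpace Ω] {μ : Measure Ω} {G : GoodGrid μ}
    (O : G.ChildOrder) where
  level : ℕ
  cell : Set Ω
  fst : List (Set Ω)
  snd : List (Set Ω)
  cell_mem : cell ∈ G.cells level
  isHaarPair : IsHaarPair (O.children level cell) fst snd

/-- The subset of `Ω` covered by a block of cells. -/
def blockSet {Ω : Type*} (S : List (Set Ω)) : Set Ω := ⋃ R ∈ S, R

/-- `∑_{R ∈ S} |R|`. -/
def blockMass {Ω : Type*} [MeasurableSpace Ω] (μ : Measure Ω) (S : List (Set Ω)) : ℝ :=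
  (S.map fun R => μ.real R).sum

/-- `∑_{R ∈ S} 1_R`. -/
def blockSum {Ω : Type*} (S : List (Set Ω)) (ω : Ω) : ℂ :=
  (S.map fun R => R.indicator (fun _ => (1 : ℂ)) ω).sum

namespace HaarPair

variable {Ω : Type*} [MeasurableSpace Ω] {μ : Measure Ω} {G : GoodGrid μ} {O : G.ChildOrder}

/-- The unbalanced Haar wavelet of a Haar pair. -/
def wavelet (p : HaarPair O) (ω : Ω) : ℂ :=
  blockSum p.fst ω / (blockMass μ p.fst : ℂ) - blockSum p.snd ω / (blockMass μ p.snd : ℂ)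

theorem mem_cells (p : HaarPair O) {R : Set Ω} (hR : R ∈ p.fst ++ p.snd) :
    R ∈ G.cells (p.level + 1) ∧ R ≤ᵐ[μ] p.cell :=
  (O.mem_children p.level p.cell p.cell_mem R).1 (p.isHaarPair.tree.2.2.subset hR)

end HaarPair

section Orthogonality

variable {Ω : Type*} [MeasurableSpace Ω] {μ : Measure Ω}

theorem GoodGrid.real_pos [IsProbabilityMeasure μ] (G : GoodGrid μ) :
    ∀ k, ∀ Q ∈ G.cells k, 0 < μ.real Q := by
  obtain ⟨a, ha, b, hb, h⟩ := G.ratio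
  intro k
  induction k with
  | zero =>
    intro Q hQ
    rw [G.cells_zero, Finset.mem_singleton] at hQ
    subst hQ
    simp
  | succ k ih =>
    intro Q hQ
    obtain ⟨P, hP, hQP⟩ := G.nested k Q hQ
    by_contra h0
    have h1 : μ.real Q = 0 := le_antisymm (not_lt.1 h0) measureReal_nonneg
    have h2 := (h k P hP Q hQ hQP).1
    rw [h1, zero_div] at h2
    exact absurd ha.1 (not_lt.2 h2)

theorem GoodGrid.ancestor (G : GoodGrid μ) (k n : ℕ) :
    ∀ R ∈ G.cells (k + n), ∃ P ∈ G.cells k, R ≤ᵐ[μ] P := by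
  induction n with
  | zero => exact fun R hR => ⟨R, hR, EventuallyLE.rfl⟩
  | succ n ih =>
    intro R hR
    obtain ⟨P, hP, hRP⟩ := G.nested (k + n) R hR
    obtain ⟨P', hP', hPP'⟩ := ih P hP
    exact ⟨P', hP', hRP.trans hPP'⟩

open scoped Classical in
theorem GoodGrid.real_inter (G : GoodGrid μ) {k : ℕ} {R P : Set Ω} (hR : R ∈ G.cells k)
    (hP : P ∈ G.cells k) {A : Set Ω} (hA : A ≤ᵐ[μ] P) :
    μ.real (R ∩ A) = if R = P then μ.real A else 0 := by
  split_ifs with h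
  · subst h
    refine measureReal_congr ?_
    filter_upwards [hA] with ω h
    exact propext ⟨fun h' => h'.2, fun h' => ⟨h h', h'⟩⟩
  · have h1 : μ (R ∩ A) ≤ μ (R ∩ P) := by
      refine measure_mono_ae ?_
      filter_upwards [hA] with ω h h'
      exact ⟨h'.1, h h'.2⟩
    rw [G.disjoint_cell k R hR P hP h] at h1
    rw [measureReal_def, le_antisymm h1 zero_le, ENNReal.toReal_zero]

theorem measurable_blockSum {S : List (Set Ω)} (hS : ∀ R ∈ S, MeasurableSet R) :
    Measurable (blockSum S) := by
  induction S with
  | nil => exact measurable_const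
  | cons R S ih =>
    have : blockSum (R :: S) = fun ω => R.indicator (fun _ => (1 : ℂ)) ω + blockSum S ω := by
      ext ω
      simp [blockSum]
    rw [this]
    exact (measurable_const.indicator (hS R (by simp))).add (ih fun R hR => hS R (by simp [hR]))

theorem norm_blockSum_le (S : List (Set Ω)) (ω : Ω) : ‖blockSum S ω‖ ≤ S.length := by
  induction S with
  | nil => simp [blockSum]
  | cons R S ih =>
    have : blockSum (R :: S) ω = R.indicator (fun _ => (1 : ℂ)) ω + blockSum S ω := by
      simp [blockSum]
    rw [this, List.length_cons]
    push_cast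
    have h1 : ‖R.indicator (fun _ => (1 : ℂ)) ω‖ ≤ 1 := by
      by_cases h : ω ∈ R <;> simp [h]
    linarith [norm_add_le (R.indicator (fun _ => (1 : ℂ)) ω) (blockSum S ω)]

theorem memLp_blockSum [IsFiniteMeasure μ] {S : List (Set Ω)}
    (hS : ∀ R ∈ S, MeasurableSet R) (r : ℝ≥0∞) : MemLp (blockSum S) r μ :=
  MemLp.of_bound (measurable_blockSum hS).aestronglyMeasurable S.length
    (ae_of_all _ (norm_blockSum_le S))

theorem integral_mul_blockSum [IsFiniteMeasure μ] {f : Ω → ℂ} (hf : Integrable f μ)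
    {S : List (Set Ω)} (hS : ∀ R ∈ S, MeasurableSet R) :
    Integrable (fun ω => f ω * blockSum S ω) μ ∧
      ∫ ω, f ω * blockSum S ω ∂μ = (S.map fun R => ∫ ω in R, f ω ∂μ).sum := by
  induction S with
  | nil => simp [blockSum]
  | cons R S ih =>
    obtain ⟨ih1, ih2⟩ := ih fun R hR => hS R (by simp [hR])
    have h : (fun ω => f ω * blockSum (R :: S) ω) =
        fun ω => R.indicator f ω + f ω * blockSum S ω := by
      ext ω
      by_cases h : ω ∈ R <;> simp [blockSum, h, mul_add]
    have hR := hS R (by simp)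
    rw [h]
    refine ⟨(hf.indicator hR).add ih1, ?_⟩
    rw [integral_add (hf.indicator hR) ih1, ih2, integral_indicator hR, List.map_cons,
      List.sum_cons]

theorem setIntegral_blockSum [IsFiniteMeasure μ] {S : List (Set Ω)}
    (hS : ∀ R ∈ S, MeasurableSet R) (A : Set Ω) :
    ∫ ω in A, blockSum S ω ∂μ = (((S.map fun R => μ.real (R ∩ A)).sum : ℝ) : ℂ) := by
  have h := (integral_mul_blockSum (μ := μ.restrict A) (f := fun _ => (1 : ℂ))
    (integrable_const _) hS).2
  simp only [one_mul] at h
  rw [h]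
  clear h
  induction S with
  | nil => simp
  | cons R S ih =>
    have hR := hS R (by simp)
    simp only [List.map_cons, List.sum_cons]
    rw [ih fun R hR => hS R (by simp [hR])]
    simp [measureReal_restrict_apply hR]

end Orthogonality

namespace HaarPair

variable {Ω : Type*} [MeasurableSpace Ω] {μ : Measure Ω} {G : GoodGrid μ} {O : G.ChildOrder}

theorem measurableSet_fst (p : HaarPair O) : ∀ R ∈ p.fst, MeasurableSet R := fun R hR =>
  G.measurable_cell _ R (p.mem_cells (List.mem_append_left _ hR)).1

theorem measurableSet_snd (p : HaarPair O) : ∀ R ∈ p.snd, MeasurableSet R := fun R hR =>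
  G.measurable_cell _ R (p.mem_cells (List.mem_append_right _ hR)).1

theorem memLp_wavelet [IsFiniteMeasure μ] (p : HaarPair O) (r : ℝ≥0∞) :
    MemLp p.wavelet r μ := by
  have h1 := (memLp_blockSum (μ := μ) p.measurableSet_fst r).mul_const
    ((blockMass μ p.fst : ℂ)⁻¹)
  have h2 := (memLp_blockSum (μ := μ) p.measurableSet_snd r).mul_const
    ((blockMass μ p.snd : ℂ)⁻¹)
  exact h1.sub h2

/-- The wavelet as an element of `L^∞`. -/
def waveletLp [IsFiniteMeasure μ] (p : HaarPair O) : Lp ℂ ∞ μ := (p.memLp_wavelet ∞).toLp _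

theorem integrable_wavelet [IsFiniteMeasure μ] (p : HaarPair O) : Integrable p.wavelet μ :=
  memLp_one_iff_integrable.1 (p.memLp_wavelet 1)

theorem integral_mul_wavelet [IsFiniteMeasure μ] (q : HaarPair O) {f : Ω → ℂ}
    (hf : Integrable f μ) :
    ∫ ω, f ω * q.wavelet ω ∂μ =
      (q.fst.map fun R => ∫ ω in R, f ω ∂μ).sum / (blockMass μ q.fst : ℂ) -
        (q.snd.map fun R => ∫ ω in R, f ω ∂μ).sum / (blockMass μ q.snd : ℂ) := by
  have h1 := integral_mul_blockSum hf q.measurableSet_fst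
  have h2 := integral_mul_blockSum hf q.measurableSet_snd
  have : (fun ω => f ω * q.wavelet ω) = fun ω =>
      f ω * blockSum q.fst ω / (blockMass μ q.fst : ℂ) -
        f ω * blockSum q.snd ω / (blockMass μ q.snd : ℂ) := by
    ext ω
    simp only [wavelet]
    ring
  rw [this, integral_sub (h1.1.div_const _) (h2.1.div_const _), integral_div, integral_div,
    h1.2, h2.2]

theorem setIntegral_wavelet [IsFiniteMeasure μ] (p : HaarPair O) (A : Set Ω) :
    ∫ ω in A, p.wavelet ω ∂μ =
      (((p.fst.map fun R => μ.real (R ∩ A)).sum : ℝ) : ℂ) / (blockMass μ p.fst : ℂ) -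
        (((p.snd.map fun R => μ.real (R ∩ A)).sum : ℝ) : ℂ) / (blockMass μ p.snd : ℂ) := by
  have h1 := memLp_one_iff_integrable.1
    (memLp_blockSum (μ := μ.restrict A) p.measurableSet_fst 1)
  have h2 := memLp_one_iff_integrable.1
    (memLp_blockSum (μ := μ.restrict A) p.measurableSet_snd 1)
  simp only [wavelet]
  rw [integral_sub (h1.div_const _) (h2.div_const _), integral_div, integral_div,
    setIntegral_blockSum p.measurableSet_fst, setIntegral_blockSum p.measurableSet_snd]

theorem blockMass_pos [IsProbabilityMeasure μ] {k : ℕ} {S : List (Set Ω)} (h0 : S ≠ [])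
    (hS : ∀ R ∈ S, R ∈ G.cells k) : 0 < blockMass μ S := by
  cases S with
  | nil => exact absurd rfl h0
  | cons R S =>
    rw [blockMass, List.map_cons, List.sum_cons]
    have h1 := G.real_pos k R (hS R (by simp))
    have h2 : 0 ≤ (S.map fun R => μ.real R).sum := List.sum_nonneg (by
      intro x hx
      obtain ⟨R', -, rfl⟩ := List.mem_map.1 hx
      exact measureReal_nonneg)
    linarith

theorem blockMass_fst_pos [IsProbabilityMeasure μ] (p : HaarPair O) : 0 < blockMass μ p.fst :=
  blockMass_pos p.isHaarPair.tree.1 fun _ hR => (p.mem_cells (List.mem_append_left _ hR)).1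

theorem blockMass_snd_pos [IsProbabilityMeasure μ] (p : HaarPair O) : 0 < blockMass μ p.snd :=
  blockMass_pos p.isHaarPair.tree.2.1 fun _ hR => (p.mem_cells (List.mem_append_right _ hR)).1

theorem sum_mul_blockMass {f : Set Ω → ℂ} {κ : ℂ} {S : List (Set Ω)}
    (h : ∀ R ∈ S, f R = κ * (μ.real R : ℂ)) : (S.map f).sum = κ * (blockMass μ S : ℂ) := by
  induction S with
  | nil => simp [blockMass]
  | cons R S ih =>
    have h1 := ih fun R hR => h R (by simp [hR])
    have h2 := h R (by simp)
    simp only [blockMass, List.map_cons, List.sum_cons] at h1 ⊢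
    rw [h1, h2]
    push_cast
    ring

/-- If `f` has the same mean on all the cells of `q`, then `f` is orthogonal to the wavelet. -/
theorem integral_mul_wavelet_eq_zero [IsProbabilityMeasure μ] (q : HaarPair O) {f : Ω → ℂ}
    (hf : Integrable f μ) {κ : ℂ}
    (h : ∀ R ∈ q.fst ++ q.snd, ∫ ω in R, f ω ∂μ = κ * (μ.real R : ℂ)) :
    ∫ ω, f ω * q.wavelet ω ∂μ = 0 := by
  have h1 : (blockMass μ q.fst : ℂ) ≠ 0 := by exact_mod_cast q.blockMass_fst_pos.ne'
  have h2 : (blockMass μ q.snd : ℂ) ≠ 0 := by exact_mod_cast q.blockMass_snd_pos.ne'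
  rw [q.integral_mul_wavelet hf,
    sum_mul_blockMass (μ := μ) fun R hR => h R (List.mem_append_left _ hR),
    sum_mul_blockMass (μ := μ) fun R hR => h R (List.mem_append_right _ hR)]
  field_simp
  ring

theorem integral_wavelet [IsProbabilityMeasure μ] (q : HaarPair O) :
    ∫ ω, q.wavelet ω ∂μ = 0 := by
  have := q.integral_mul_wavelet_eq_zero (f := fun _ => (1 : ℂ)) (κ := 1) (integrable_const _)
    (by simp)
  simpa using this

open scoped Classical in
/-- The integral of the wavelet over a set contained in a cell of the next level. -/
theorem setIntegral_wavelet_of_le [IsFiniteMeasure μ] (p : HaarPair O) {P A : Set Ω}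
    (hP : P ∈ G.cells (p.level + 1)) (hA : A ≤ᵐ[μ] P) :
    ∫ ω in A, p.wavelet ω ∂μ =
      ((p.fst.count P : ℂ) / (blockMass μ p.fst : ℂ) -
        (p.snd.count P : ℂ) / (blockMass μ p.snd : ℂ)) * (μ.real A : ℂ) := by
  have key : ∀ S : List (Set Ω), (∀ R ∈ S, R ∈ G.cells (p.level + 1)) →
      (S.map fun R => μ.real (R ∩ A)).sum = (S.count P : ℝ) * μ.real A := by
    intro S hS
    induction S with
    | nil => simp
    | cons R S ih =>
      rw [List.map_cons, List.sum_cons, ih fun R hR => hS R (by simp [hR]),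
        G.real_inter (hS R (by simp)) hP hA, List.count_cons]
      by_cases h : R = P
      · simp [h]
        ring
      · simp [h]
  rw [setIntegral_wavelet, key _ fun R hR => (p.mem_cells (List.mem_append_left _ hR)).1,
    key _ fun R hR => (p.mem_cells (List.mem_append_right _ hR)).1]
  push_cast
  ring

theorem orthogonal_of_level_lt [IsProbabilityMeasure μ] (p q : HaarPair O)
    (h : p.level < q.level) : ∫ ω, p.wavelet ω * q.wavelet ω ∂μ = 0 := by
  classical
  obtain ⟨n, hn⟩ := Nat.exists_eq_add_of_le (Nat.succ_le_of_lt h)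
  obtain ⟨P, hP, hqP⟩ := G.ancestor (p.level + 1) n q.cell (hn ▸ q.cell_mem)
  exact q.integral_mul_wavelet_eq_zero p.integrable_wavelet fun R hR =>
    p.setIntegral_wavelet_of_le hP ((q.mem_cells hR).2.trans hqP)

theorem integral_mul_comm (p q : HaarPair O) :
    ∫ ω, p.wavelet ω * q.wavelet ω ∂μ = ∫ ω, q.wavelet ω * p.wavelet ω ∂μ :=
  integral_congr_ae (ae_of_all _ fun _ => mul_comm _ _)

theorem nodup_append (p : HaarPair O) : (p.fst ++ p.snd).Nodup :=
  (O.nodup _ _ p.cell_mem).sublist p.isHaarPair.tree.2.2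

theorem orthogonal_of_subset [IsProbabilityMeasure μ] (p q : HaarPair O)
    (hl : p.level = q.level) (h : (q.fst ++ q.snd ⊆ p.fst) ∨ (q.fst ++ q.snd ⊆ p.snd) ∨
      (p.fst ++ p.snd).Disjoint (q.fst ++ q.snd)) :
    ∫ ω, p.wavelet ω * q.wavelet ω ∂μ = 0 := by
  classical
  have hnd := List.nodup_append.1 p.nodup_append
  have hdis := List.disjoint_of_nodup_append p.nodup_append
  have hq : ∀ R ∈ q.fst ++ q.snd, R ∈ G.cells (p.level + 1) := by
    intro R hR
    rw [hl]
    exact (q.mem_cells hR).1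
  rcases h with h | h | h
  · refine q.integral_mul_wavelet_eq_zero (κ := (1 : ℂ) / (blockMass μ p.fst : ℂ))
      p.integrable_wavelet fun R hR => ?_
    rw [p.setIntegral_wavelet_of_le (hq R hR) EventuallyLE.rfl,
      List.count_eq_one_of_mem hnd.1 (h hR), List.count_eq_zero_of_not_mem (hdis (h hR))]
    simp
  · refine q.integral_mul_wavelet_eq_zero (κ := -((1 : ℂ) / (blockMass μ p.snd : ℂ)))
      p.integrable_wavelet fun R hR => ?_
    rw [p.setIntegral_wavelet_of_le (hq R hR) EventuallyLE.rfl,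
      List.count_eq_one_of_mem hnd.2.1 (h hR),
      List.count_eq_zero_of_not_mem fun h' => hdis h' (h hR)]
    simp
  · refine q.integral_mul_wavelet_eq_zero p.integrable_wavelet (κ := 0) fun R hR => ?_
    rw [p.setIntegral_wavelet_of_le (hq R hR) EventuallyLE.rfl,
      List.count_eq_zero_of_not_mem fun h' => h (List.mem_append_left _ h') hR,
      List.count_eq_zero_of_not_mem fun h' => h (List.mem_append_right _ h') hR]
    simp

theorem orthogonal [IsProbabilityMeasure μ] (p q : HaarPair O) (hpq : p ≠ q) :
    ∫ ω, p.wavelet ω * q.wavelet ω ∂μ = 0 := by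
  rcases lt_trichotomy p.level q.level with h | h | h
  · exact p.orthogonal_of_level_lt q h
  · by_cases hc : p.cell = q.cell
    · have hp := p.isHaarPair
      have hq := q.isHaarPair
      rw [← h, ← hc] at hq
      rcases hp.dichotomy (O.nodup _ _ p.cell_mem) hq with h1 | h1 | h1 | h1 | h1 | h1
      · exfalso
        apply hpq
        cases p
        cases q
        simp_all
      · exact p.orthogonal_of_subset q h (Or.inl h1)
      · exact p.orthogonal_of_subset q h (Or.inr (Or.inl h1))
      · rw [integral_mul_comm]
        exact q.orthogonal_of_subset p h.symm (Or.inl h1)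
      · rw [integral_mul_comm]
        exact q.orthogonal_of_subset p h.symm (Or.inr (Or.inl h1))
      · exact p.orthogonal_of_subset q h (Or.inr (Or.inr h1))
    · refine p.orthogonal_of_subset q h (Or.inr (Or.inr ?_))
      intro R hRp hRq
      have h1 := p.mem_cells hRp
      have h2 := q.mem_cells hRq
      have h3 : μ R ≤ μ (p.cell ∩ q.cell) := by
        refine measure_mono_ae ?_
        filter_upwards [h1.2, h2.2] with ω a b c
        exact ⟨a c, b c⟩
      rw [G.disjoint_cell p.level _ p.cell_mem _ (h ▸ q.cell_mem) hc] at h3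
      have h4 := G.real_pos _ R h1.1
      rw [measureReal_def, le_antisymm h3 zero_le, ENNReal.toReal_zero] at h4
      exact lt_irrefl _ h4
  · rw [integral_mul_comm]
    exact q.orthogonal_of_level_lt p h

theorem integral_wavelet_sq_ne_zero [IsProbabilityMeasure μ] (p : HaarPair O) :
    ∫ ω, p.wavelet ω * p.wavelet ω ∂μ ≠ 0 := by
  classical
  have hnd := List.nodup_append.1 p.nodup_append
  have hdis := List.disjoint_of_nodup_append p.nodup_append
  have hm1 := p.blockMass_fst_pos
  have hm2 := p.blockMass_snd_pos
  have h1 : (blockMass μ p.fst : ℂ) ≠ 0 := by exact_mod_cast hm1.ne'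
  have h2 : (blockMass μ p.snd : ℂ) ≠ 0 := by exact_mod_cast hm2.ne'
  have e1 : ∀ R ∈ p.fst, ∫ ω in R, p.wavelet ω ∂μ =
      (1 / (blockMass μ p.fst : ℂ)) * (μ.real R : ℂ) := by
    intro R hR
    rw [p.setIntegral_wavelet_of_le (p.mem_cells (List.mem_append_left _ hR)).1 EventuallyLE.rfl,
      List.count_eq_one_of_mem hnd.1 hR, List.count_eq_zero_of_not_mem (hdis hR)]
    simp
  have e2 : ∀ R ∈ p.snd, ∫ ω in R, p.wavelet ω ∂μ =
      (-(1 / (blockMass μ p.snd : ℂ))) * (μ.real R : ℂ) := by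
    intro R hR
    rw [p.setIntegral_wavelet_of_le (p.mem_cells (List.mem_append_right _ hR)).1 EventuallyLE.rfl,
      List.count_eq_one_of_mem hnd.2.1 hR, List.count_eq_zero_of_not_mem fun h' => hdis h' hR]
    simp
  rw [p.integral_mul_wavelet p.integrable_wavelet, sum_mul_blockMass e1, sum_mul_blockMass e2]
  have h3 : 0 < 1 / blockMass μ p.fst + 1 / blockMass μ p.snd := by positivity
  have h4 : ((1 / blockMass μ p.fst + 1 / blockMass μ p.snd : ℝ) : ℂ) ≠ 0 := by
    exact_mod_cast h3.ne'
  convert h4 using 1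
  push_cast
  field_simp
  ring

end HaarPair

section Besov

variable {Ω : Type*} [MeasurableSpace Ω] {μ : Measure Ω} [IsProbabilityMeasure μ]
  {G : GoodGrid μ}

/-- `ψ = c 1_I + ∑_p |Q_p|^(1+s) a_p φ_p` in `L^∞`, with bounded coefficients `a_p`. -/
def HasHaarSeries (O : G.ChildOrder) (s : ℝ) (ψ : Lp ℂ ∞ μ) (c : ℂ) (a : HaarPair O → ℂ) :
    Prop :=
  BddAbove (range fun p => ‖a p‖) ∧
    HasSum (fun p : HaarPair O => (((μ.real p.cell ^ (1 + s) : ℝ) : ℂ) * a p) • p.waveletLp)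
      (ψ - Lp.const ∞ μ c)

variable {O : G.ChildOrder} {s : ℝ}

/-- Integration against a function in `L¹`, as a continuous functional on `L^∞`. -/
def integralMul (μ : Measure Ω) (f : Ω → ℂ) (hf : MemLp f 1 μ) : Lp ℂ ∞ μ →L[ℂ] ℂ :=
  haveI : ENNReal.HolderConjugate ∞ 1 := ENNReal.HolderConjugate.top_one
  ((ContinuousLinearMap.mul ℂ ℂ).lpPairing μ ∞ 1).flip (hf.toLp f)

theorem integralMul_apply {f : Ω → ℂ} (hf : MemLp f 1 μ) (ψ : Lp ℂ ∞ μ) :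
    integralMul μ f hf ψ = ∫ ω, ψ ω * f ω ∂μ := by
  have : ENNReal.HolderConjugate ∞ 1 := ENNReal.HolderConjugate.top_one
  rw [integralMul, ContinuousLinearMap.flip_apply, ContinuousLinearMap.lpPairing_eq_integral]
  refine integral_congr_ae ?_
  filter_upwards [hf.coeFn_toLp] with ω h
  simp [h]

theorem integral_waveletLp_mul (p : HaarPair O) (f : Ω → ℂ) :
    ∫ ω, p.waveletLp ω * f ω ∂μ = ∫ ω, p.wavelet ω * f ω ∂μ := by
  refine integral_congr_ae ?_
  filter_upwards [(p.memLp_wavelet ∞).coeFn_toLp] with ω h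
  rw [HaarPair.waveletLp, h]

theorem integral_const_mul_Lp (c : ℂ) (f : Ω → ℂ) :
    ∫ ω, (Lp.const ∞ μ c : Lp ℂ ∞ μ) ω * f ω ∂μ = c * ∫ ω, f ω ∂μ := by
  rw [← integral_const_mul]
  refine integral_congr_ae ?_
  filter_upwards [Lp.coeFn_const (p := ∞) (μ := μ) c] with ω h
  rw [h, Function.const_apply]

theorem HasHaarSeries.const_eq {ψ : Lp ℂ ∞ μ} {c : ℂ} {a : HaarPair O → ℂ}
    (h : HasHaarSeries O s ψ c a) : c = ∫ ω, ψ ω ∂μ := by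
  have h1 := h.2.mapL (integralMul μ (fun _ => (1 : ℂ)) (memLp_const 1))
  have h2 : ∀ p : HaarPair O, integralMul μ (fun _ => (1 : ℂ)) (memLp_const 1)
      ((((μ.real p.cell ^ (1 + s) : ℝ) : ℂ) * a p) • p.waveletLp) = 0 := by
    intro p
    rw [map_smul, integralMul_apply, integral_waveletLp_mul]
    simp [p.integral_wavelet]
  simp only [h2] at h1
  have h3 := h1.unique hasSum_zero
  rw [map_sub, integralMul_apply, integralMul_apply, integral_const_mul_Lp] at h3
  simp at h3
  exact (sub_eq_zero.1 h3).symm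

theorem HasHaarSeries.coeff_eq {ψ : Lp ℂ ∞ μ} {c : ℂ} {a : HaarPair O → ℂ}
    (h : HasHaarSeries O s ψ c a) (q : HaarPair O) :
    ((μ.real q.cell ^ (1 + s) : ℝ) : ℂ) * a q * ∫ ω, q.wavelet ω * q.wavelet ω ∂μ =
      ∫ ω, ψ ω * q.wavelet ω ∂μ := by
  have h1 := h.2.mapL (integralMul μ q.wavelet (q.memLp_wavelet 1))
  have h2 : ∀ p : HaarPair O, p ≠ q → integralMul μ q.wavelet (q.memLp_wavelet 1)
      ((((μ.real p.cell ^ (1 + s) : ℝ) : ℂ) * a p) • p.waveletLp) = 0 := by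
    intro p hp
    rw [map_smul, integralMul_apply, integral_waveletLp_mul, p.orthogonal q hp, smul_zero]
  have h3 := h1.unique (hasSum_single q h2)
  rw [map_sub, integralMul_apply, integralMul_apply, integral_const_mul_Lp, map_smul,
    integralMul_apply, integral_waveletLp_mul, q.integral_wavelet] at h3
  rw [mul_zero, sub_zero, smul_eq_mul] at h3
  exact h3.symm

theorem HaarPair.rpow_ne_zero (q : HaarPair O) (t : ℝ) :
    ((μ.real q.cell ^ t : ℝ) : ℂ) ≠ 0 := by
  exact_mod_cast (Real.rpow_pos_of_pos (G.real_pos _ _ q.cell_mem) t).ne'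

theorem HasHaarSeries.unique {ψ : Lp ℂ ∞ μ} {c c' : ℂ} {a a' : HaarPair O → ℂ}
    (h : HasHaarSeries O s ψ c a) (h' : HasHaarSeries O s ψ c' a') : c = c' ∧ a = a' := by
  refine ⟨h.const_eq.trans h'.const_eq.symm, funext fun q => ?_⟩
  have h1 := (h.coeff_eq q).trans (h'.coeff_eq q).symm
  exact mul_left_cancel₀ (q.rpow_ne_zero _)
    (mul_right_cancel₀ q.integral_wavelet_sq_ne_zero h1)

theorem HasHaarSeries.zero : HasHaarSeries O s (0 : Lp ℂ ∞ μ) 0 0 := by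
  refine ⟨⟨0, by rintro _ ⟨p, rfl⟩; simp⟩, ?_⟩
  simp [hasSum_zero]

theorem HasHaarSeries.add {ψ ψ' : Lp ℂ ∞ μ} {c c' : ℂ} {a a' : HaarPair O → ℂ}
    (h : HasHaarSeries O s ψ c a) (h' : HasHaarSeries O s ψ' c' a') :
    HasHaarSeries O s (ψ + ψ') (c + c') (a + a') := by
  refine ⟨?_, ?_⟩
  · obtain ⟨C, hC⟩ := h.1
    obtain ⟨C', hC'⟩ := h'.1
    refine ⟨C + C', ?_⟩
    rintro _ ⟨p, rfl⟩
    exact (norm_add_le _ _).trans (add_le_add (hC ⟨p, rfl⟩) (hC' ⟨p, rfl⟩))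
  · have h1 := h.2.add h'.2
    convert h1 using 1
    · ext1 p
      rw [Pi.add_apply, mul_add, add_smul]
    · rw [map_add]
      abel

theorem HasHaarSeries.smul {ψ : Lp ℂ ∞ μ} {c : ℂ} {a : HaarPair O → ℂ} (z : ℂ)
    (h : HasHaarSeries O s ψ c a) : HasHaarSeries O s (z • ψ) (z • c) (z • a) := by
  refine ⟨?_, ?_⟩
  · obtain ⟨C, hC⟩ := h.1
    refine ⟨‖z‖ * C, ?_⟩
    rintro _ ⟨p, rfl⟩
    simp only [Pi.smul_apply, norm_smul]
    exact mul_le_mul_of_nonneg_left (hC ⟨p, rfl⟩) (norm_nonneg z)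
  · have h1 := h.2.const_smul z
    convert h1 using 1
    · ext1 p
      rw [Pi.smul_apply, smul_eq_mul, smul_smul]
      congr 1
      ring
    · rw [smul_sub]
      congr 1

/-- The functions in `B^s_{∞,∞}`, as a subspace of `L^∞`. -/
def besovPosSubmodule (O : G.ChildOrder) (s : ℝ) : Submodule ℂ (Lp ℂ ∞ μ) where
  carrier := {ψ | ∃ c a, HasHaarSeries O s ψ c a}
  zero_mem' := ⟨0, 0, HasHaarSeries.zero⟩
  add_mem' := by
    rintro ψ ψ' ⟨c, a, h⟩ ⟨c', a', h'⟩
    exact ⟨_, _, h.add h'⟩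
  smul_mem' := by
    rintro z ψ ⟨c, a, h⟩
    exact ⟨_, _, h.smul z⟩

/-- The Besov space `B^s_{∞,∞}`. It is given its own norm below, not the norm of `L^∞`. -/
def BesovPos (O : G.ChildOrder) (s : ℝ) : Type _ := besovPosSubmodule O s

namespace BesovPos

instance : AddCommGroup (BesovPos O s) := inferInstanceAs (AddCommGroup (besovPosSubmodule O s))

instance : Module ℂ (BesovPos O s) := inferInstanceAs (Module ℂ (besovPosSubmodule O s))

/-- The underlying class of functions in `L^∞`. -/
def toLp (ψ : BesovPos O s) : Lp ℂ ∞ μ := Subtype.val ψ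

/-- The coefficient `c_I`. -/
def constCoeff (ψ : BesovPos O s) : ℂ := Classical.choose ψ.2

/-- The coefficients `c_{(S₁,S₂)}`. -/
def coeff (ψ : BesovPos O s) : HaarPair O → ℂ := Classical.choose (Classical.choose_spec ψ.2)

theorem hasHaarSeries (ψ : BesovPos O s) : HasHaarSeries O s ψ.toLp ψ.constCoeff ψ.coeff :=
  Classical.choose_spec (Classical.choose_spec ψ.2)

theorem eq_coeff {ψ : BesovPos O s} {c : ℂ} {a : HaarPair O → ℂ}
    (h : HasHaarSeries O s ψ.toLp c a) : ψ.constCoeff = c ∧ ψ.coeff = a :=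
  ψ.hasHaarSeries.unique h

theorem coeff_add (ψ ψ' : BesovPos O s) : (ψ + ψ').constCoeff = ψ.constCoeff + ψ'.constCoeff ∧
    (ψ + ψ').coeff = ψ.coeff + ψ'.coeff :=
  eq_coeff (ψ.hasHaarSeries.add ψ'.hasHaarSeries)

theorem coeff_smul (z : ℂ) (ψ : BesovPos O s) : (z • ψ).constCoeff = z • ψ.constCoeff ∧
    (z • ψ).coeff = z • ψ.coeff :=
  eq_coeff (ψ.hasHaarSeries.smul z)

instance : Norm (BesovPos O s) := ⟨fun ψ => ‖ψ.constCoeff‖ + ⨆ p, ‖ψ.coeff p‖⟩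

theorem norm_def (ψ : BesovPos O s) : ‖ψ‖ = ‖ψ.constCoeff‖ + ⨆ p, ‖ψ.coeff p‖ := rfl

theorem norm_core : NormedSpace.Core ℂ (BesovPos O s) where
  norm_nonneg ψ := add_nonneg (norm_nonneg _) (Real.iSup_nonneg fun _ => norm_nonneg _)
  norm_smul z ψ := by
    rw [norm_def, norm_def, (coeff_smul z ψ).1, (coeff_smul z ψ).2, mul_add, norm_smul,
      Real.mul_iSup_of_nonneg (norm_nonneg z)]
    simp only [Pi.smul_apply, norm_smul]
  norm_triangle ψ ψ' := by
    rw [norm_def, norm_def, norm_def, (coeff_add ψ ψ').1, (coeff_add ψ ψ').2]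
    have h1 := norm_add_le ψ.constCoeff ψ'.constCoeff
    have h2 : ⨆ p, ‖(ψ.coeff + ψ'.coeff) p‖ ≤ (⨆ p, ‖ψ.coeff p‖) + ⨆ p, ‖ψ'.coeff p‖ := by
      refine Real.iSup_le (fun p => ?_) (add_nonneg (Real.iSup_nonneg fun _ => norm_nonneg _)
        (Real.iSup_nonneg fun _ => norm_nonneg _))
      exact (norm_add_le _ _).trans
        (add_le_add (le_ciSup ψ.hasHaarSeries.1 p) (le_ciSup ψ'.hasHaarSeries.1 p))
    linarith
  norm_eq_zero_iff ψ := by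
    constructor
    · intro h
      rw [norm_def] at h
      have h0 : 0 ≤ ⨆ p, ‖ψ.coeff p‖ := Real.iSup_nonneg fun _ => norm_nonneg _
      have h1 : ψ.constCoeff = 0 := norm_eq_zero.1 (by linarith [norm_nonneg ψ.constCoeff])
      have h2 : ∀ p, ψ.coeff p = 0 := fun p => norm_le_zero_iff.1
        ((le_ciSup ψ.hasHaarSeries.1 p).trans (by linarith [norm_nonneg ψ.constCoeff]))
      have h3 := ψ.hasHaarSeries.2
      simp only [h1, h2, mul_zero, zero_smul, map_zero, sub_zero] at h3
      exact Subtype.ext (h3.unique hasSum_zero)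
    · rintro rfl
      have h := eq_coeff (ψ := (0 : BesovPos O s)) HasHaarSeries.zero
      rw [norm_def, h.1, h.2]
      simp

/-- The norm `|c_I| + sup |c_{(S₁,S₂)}|`. -/
instance : NormedAddCommGroup (BesovPos O s) := NormedAddCommGroup.ofCore norm_core

instance : NormedSpace ℂ (BesovPos O s) := NormedSpace.ofCore norm_core

end BesovPos

/-- The functional `φ` is `d 1_I + ∑_p b_p |Q_p|^(-s) φ_p`, with `∑_p |b_p| < ∞`. -/
def HasDualSeries (O : G.ChildOrder) (s : ℝ) (φ : StrongDual ℂ (BesovPos O s)) (d : ℂ)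
    (b : HaarPair O → ℂ) : Prop :=
  Summable (fun p => ‖b p‖) ∧ ∀ ψ : BesovPos O s,
    HasSum (fun p : HaarPair O => b p * ((μ.real p.cell ^ (-s) : ℝ) : ℂ) *
      ∫ ω, ψ.toLp ω * p.wavelet ω ∂μ) (φ ψ - d * ∫ ω, ψ.toLp ω ∂μ)

/-- The constant function `1` in `B^s_{∞,∞}`. -/
def BesovPos.one (O : G.ChildOrder) (s : ℝ) : BesovPos O s :=
  ⟨Lp.const ∞ μ 1, 1, 0, ⟨0, by rintro _ ⟨p, rfl⟩; simp⟩, by simp [hasSum_zero]⟩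

open scoped Classical in
/-- The Haar wavelets belong to `B^s_{∞,∞}`. -/
def BesovPos.ofPair (s : ℝ) (q : HaarPair O) : BesovPos O s :=
  ⟨q.waveletLp, 0, Pi.single q (((μ.real q.cell ^ (1 + s) : ℝ) : ℂ)⁻¹),
    ⟨‖((μ.real q.cell ^ (1 + s) : ℝ) : ℂ)⁻¹‖, by
      rintro _ ⟨p, rfl⟩
      by_cases h : p = q
      · subst h
        simp
      · simp [Pi.single_eq_of_ne h]⟩, by
    have h := hasSum_single (f := fun p : HaarPair O => (((μ.real p.cell ^ (1 + s) : ℝ) : ℂ) *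
      (Pi.single q (((μ.real q.cell ^ (1 + s) : ℝ) : ℂ)⁻¹) : HaarPair O → ℂ) p) • p.waveletLp) q
      (fun p hp => by simp [Pi.single_eq_of_ne hp])
    convert h using 1
    rw [Pi.single_eq_same, mul_inv_cancel₀ (q.rpow_ne_zero _), one_smul, map_zero, sub_zero]⟩

theorem HasDualSeries.const_eq {φ : StrongDual ℂ (BesovPos O s)} {d : ℂ} {b : HaarPair O → ℂ}
    (h : HasDualSeries O s φ d b) : d = φ (BesovPos.one O s) := by
  have h1 := h.2 (BesovPos.one O s)
  have h2 : ∀ f : Ω → ℂ, ∫ ω, (BesovPos.one O s).toLp ω * f ω ∂μ = ∫ ω, f ω ∂μ := fun f =>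
    (integral_const_mul_Lp (μ := μ) 1 f).trans (one_mul _)
  have h3 := h2 fun _ => 1
  simp only [mul_one, integral_const, probReal_univ, one_smul] at h3
  simp only [h2, h3, HaarPair.integral_wavelet, mul_zero, mul_one] at h1
  exact (sub_eq_zero.1 (h1.unique hasSum_zero)).symm

theorem HasDualSeries.coeff_eq {φ : StrongDual ℂ (BesovPos O s)} {d : ℂ} {b : HaarPair O → ℂ}
    (h : HasDualSeries O s φ d b) (q : HaarPair O) :
    b q * ((μ.real q.cell ^ (-s) : ℝ) : ℂ) * ∫ ω, q.wavelet ω * q.wavelet ω ∂μ =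
      φ (BesovPos.ofPair s q) := by
  have h1 := h.2 (BesovPos.ofPair s q)
  have h2 : ∀ f : Ω → ℂ, ∫ ω, (BesovPos.ofPair s q).toLp ω * f ω ∂μ =
      ∫ ω, q.wavelet ω * f ω ∂μ := fun f => integral_waveletLp_mul q f
  have h3 := h2 fun _ => 1
  simp only [mul_one, q.integral_wavelet] at h3
  simp only [h2, h3, mul_zero, sub_zero] at h1
  refine (hasSum_single q fun p hp => ?_).unique h1
  rw [q.orthogonal p hp.symm, mul_zero]

theorem HasDualSeries.unique {φ : StrongDual ℂ (BesovPos O s)} {d d' : ℂ} {b b' : HaarPair O → ℂ}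
    (h : HasDualSeries O s φ d b) (h' : HasDualSeries O s φ d' b') : d = d' ∧ b = b' := by
  refine ⟨h.const_eq.trans h'.const_eq.symm, funext fun q => ?_⟩
  have h1 := (h.coeff_eq q).trans (h'.coeff_eq q).symm
  exact mul_right_cancel₀ (q.rpow_ne_zero _)
    (mul_right_cancel₀ q.integral_wavelet_sq_ne_zero h1)

theorem HasDualSeries.zero : HasDualSeries O s 0 0 0 := by
  refine ⟨by simp [summable_zero], fun ψ => ?_⟩
  simp [hasSum_zero]

theorem HasDualSeries.add {φ φ' : StrongDual ℂ (BesovPos O s)} {d d' : ℂ} {b b' : HaarPair O → ℂ}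
    (h : HasDualSeries O s φ d b) (h' : HasDualSeries O s φ' d' b') :
    HasDualSeries O s (φ + φ') (d + d') (b + b') := by
  refine ⟨?_, fun ψ => ?_⟩
  · exact (h.1.add h'.1).of_nonneg_of_le (fun _ => norm_nonneg _) fun p => norm_add_le _ _
  · have h1 := (h.2 ψ).add (h'.2 ψ)
    convert h1 using 1
    · ext1 p
      rw [Pi.add_apply]
      ring
    · rw [add_apply]
      ring

theorem HasDualSeries.smul {φ : StrongDual ℂ (BesovPos O s)} {d : ℂ} {b : HaarPair O → ℂ} (z : ℂ)
    (h : HasDualSeries O s φ d b) : HasDualSeries O s (z • φ) (z • d) (z • b) := by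
  refine ⟨?_, fun ψ => ?_⟩
  · simpa only [Pi.smul_apply, norm_smul] using h.1.mul_left ‖z‖
  · have h1 := (h.2 ψ).mul_left z
    have h2 : (fun p : HaarPair O => (z • b) p * ((μ.real p.cell ^ (-s) : ℝ) : ℂ) *
        ∫ ω, ψ.toLp ω * p.wavelet ω ∂μ) = fun p => z * (b p * ((μ.real p.cell ^ (-s) : ℝ) : ℂ) *
        ∫ ω, ψ.toLp ω * p.wavelet ω ∂μ) := by
      ext1 p
      rw [Pi.smul_apply, smul_eq_mul]
      ring
    have h3 : (z • φ) ψ - z • d * ∫ ω, ψ.toLp ω ∂μ = z * (φ ψ - d * ∫ ω, ψ.toLp ω ∂μ) := by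
      rw [smul_apply, smul_eq_mul, smul_eq_mul]
      ring
    rw [h2, h3]
    exact h1

/-- The distributions in `B^{-s}_{1,1}`, as a subspace of the dual of `B^s_{∞,∞}`. -/
def besovNegSubmodule (O : G.ChildOrder) (s : ℝ) : Submodule ℂ (StrongDual ℂ (BesovPos O s)) where
  carrier := {φ | ∃ d b, HasDualSeries O s φ d b}
  zero_mem' := ⟨0, 0, HasDualSeries.zero⟩
  add_mem' := by
    rintro φ φ' ⟨d, b, h⟩ ⟨d', b', h'⟩
    exact ⟨_, _, h.add h'⟩
  smul_mem' := by
    rintro z φ ⟨d, b, h⟩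
    exact ⟨_, _, h.smul z⟩

/-- The Besov space `B^{-s}_{1,1}`. It is given its own norm below, not the dual norm. -/
def BesovNeg (O : G.ChildOrder) (s : ℝ) : Type _ := besovNegSubmodule O s

namespace BesovNeg

instance : AddCommGroup (BesovNeg O s) := inferInstanceAs (AddCommGroup (besovNegSubmodule O s))

instance : Module ℂ (BesovNeg O s) := inferInstanceAs (Module ℂ (besovNegSubmodule O s))

/-- The underlying continuous functional on `B^s_{∞,∞}`. -/
def toDual (φ : BesovNeg O s) : StrongDual ℂ (BesovPos O s) := Subtype.val φ

/-- The coefficient `d_I`. -/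
def constCoeff (φ : BesovNeg O s) : ℂ := Classical.choose φ.2

/-- The coefficients `d_{(S₁,S₂)}`. -/
def coeff (φ : BesovNeg O s) : HaarPair O → ℂ := Classical.choose (Classical.choose_spec φ.2)

theorem hasDualSeries (φ : BesovNeg O s) : HasDualSeries O s φ.toDual φ.constCoeff φ.coeff :=
  Classical.choose_spec (Classical.choose_spec φ.2)

theorem eq_coeff {φ : BesovNeg O s} {d : ℂ} {b : HaarPair O → ℂ}
    (h : HasDualSeries O s φ.toDual d b) : φ.constCoeff = d ∧ φ.coeff = b :=
  φ.hasDualSeries.unique h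

theorem coeff_add (φ φ' : BesovNeg O s) : (φ + φ').constCoeff = φ.constCoeff + φ'.constCoeff ∧
    (φ + φ').coeff = φ.coeff + φ'.coeff :=
  eq_coeff (φ.hasDualSeries.add φ'.hasDualSeries)

theorem coeff_smul (z : ℂ) (φ : BesovNeg O s) : (z • φ).constCoeff = z • φ.constCoeff ∧
    (z • φ).coeff = z • φ.coeff :=
  eq_coeff (φ.hasDualSeries.smul z)

instance : Norm (BesovNeg O s) := ⟨fun φ => ‖φ.constCoeff‖ + ∑' p, ‖φ.coeff p‖⟩

theorem norm_def (φ : BesovNeg O s) : ‖φ‖ = ‖φ.constCoeff‖ + ∑' p, ‖φ.coeff p‖ := rfl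

theorem norm_core : NormedSpace.Core ℂ (BesovNeg O s) where
  norm_nonneg φ := add_nonneg (norm_nonneg _) (tsum_nonneg fun _ => norm_nonneg _)
  norm_smul z φ := by
    rw [norm_def, norm_def, (coeff_smul z φ).1, (coeff_smul z φ).2, mul_add, norm_smul,
      ← tsum_mul_left]
    simp only [Pi.smul_apply, norm_smul]
  norm_triangle φ φ' := by
    rw [norm_def, norm_def, norm_def, (coeff_add φ φ').1, (coeff_add φ φ').2]
    have h1 := norm_add_le φ.constCoeff φ'.constCoeff
    have h2 := (φ.hasDualSeries.add φ'.hasDualSeries).1.tsum_le_tsum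
      (fun p => norm_add_le (φ.coeff p) (φ'.coeff p))
      (φ.hasDualSeries.1.add φ'.hasDualSeries.1)
    rw [φ.hasDualSeries.1.tsum_add φ'.hasDualSeries.1] at h2
    simp only [Pi.add_apply]
    linarith
  norm_eq_zero_iff φ := by
    constructor
    · intro h
      rw [norm_def] at h
      have h0 : 0 ≤ ∑' p, ‖φ.coeff p‖ := tsum_nonneg fun _ => norm_nonneg _
      have h1 : φ.constCoeff = 0 := norm_eq_zero.1 (by linarith [norm_nonneg φ.constCoeff])
      have h2 : ∀ p, φ.coeff p = 0 := fun p => norm_le_zero_iff.1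
        ((φ.hasDualSeries.1.le_tsum p fun _ _ => norm_nonneg _).trans
          (by linarith [norm_nonneg φ.constCoeff]))
      refine Subtype.ext (ContinuousLinearMap.ext fun ψ => ?_)
      have h3 := φ.hasDualSeries.2 ψ
      simp only [h1, h2, zero_mul, sub_zero] at h3
      exact h3.unique hasSum_zero
    · rintro rfl
      have h := eq_coeff (φ := (0 : BesovNeg O s)) HasDualSeries.zero
      rw [norm_def, h.1, h.2]
      simp

/-- The norm `|d_I| + ∑ |d_{(S₁,S₂)}|`. -/
instance : NormedAddCommGroup (BesovNeg O s) := NormedAddCommGroup.ofCore norm_core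

instance : NormedSpace ℂ (BesovNeg O s) := NormedSpace.ofCore norm_core

end BesovNeg

end Besov

section Dipoles

variable {Ω : Type*} [MeasurableSpace Ω] {μ : Measure Ω} {G : GoodGrid μ}

/-- A sequence `(Q₀, Q₁, ...)` of cells with `Q₀ = I` and `Q_{j+1}` a child of `Q_j`. -/
structure GoodGrid.Point (G : GoodGrid μ) where
  seq : ℕ → Set Ω
  seq_zero : seq 0 = univ
  seq_mem : ∀ j, seq j ∈ G.cells j
  seq_succ : ∀ j, seq (j + 1) ≤ᵐ[μ] seq j

/-- The point `x = (Q₀, Q₁, ...)` lies in `A`: some `Q_j` is contained in `A` up to a null set. -/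
def GoodGrid.Point.IsIn (x : G.Point) (A : Set Ω) : Prop := ∃ j, x.seq j ≤ᵐ[μ] A

/-- `δ` is the Dirac mass at `x`: the limit in `B^{-s}_{1,1}` of `1_{Q_j} / |Q_j|`. -/
def IsDiracMass [IsProbabilityMeasure μ] (O : G.ChildOrder) (s : ℝ) (x : G.Point)
    (δ : BesovNeg O s) : Prop :=
  ∃ u : ℕ → BesovNeg O s,
    (∀ j (ψ : BesovPos O s), (u j).toDual ψ =
      (∫ ω in x.seq j, ψ.toLp ω ∂μ) / (μ.real (x.seq j) : ℂ)) ∧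
    Tendsto u atTop (𝓝 δ)

namespace GoodGrid.ChildOrder

/-- The family `F` of the sets `I`, `P₁` and `P₂`, for all Haar pairs `(P₁, P₂)`. -/
def family (O : G.ChildOrder) : Set (Set Ω) :=
  {A | A = univ ∨ ∃ p : HaarPair O, A = blockSet p.fst ∨ A = blockSet p.snd}

/-- `I` as a member of the family. -/
def whole (O : G.ChildOrder) : O.family := ⟨univ, Or.inl rfl⟩

/-- `P₁` as a member of the family. -/
def firstHalf (O : G.ChildOrder) (p : HaarPair O) : O.family :=
  ⟨blockSet p.fst, Or.inr ⟨p, Or.inl rfl⟩⟩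

/-- `P₂` as a member of the family. -/
def secondHalf (O : G.ChildOrder) (p : HaarPair O) : O.family :=
  ⟨blockSet p.snd, Or.inr ⟨p, Or.inr rfl⟩⟩

/-- The choices of points that define a dipole basis: `x_P` lies in `P`, and
`x_P = x_Q` whenever `P ⊆ Q` and `x_Q` lies in `P`. -/
structure IsDipoleChoice (O : G.ChildOrder) (x : O.family → G.Point) : Prop where
  isIn : ∀ P : O.family, (x P).IsIn P.1
  eq_of_isIn : ∀ P Q : O.family, P.1 ≤ᵐ[μ] Q.1 → (x Q).IsIn P.1 → x P = x Q

end GoodGrid.ChildOrder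

end Dipoles

end

/-! Let p = (P₁, P₂) be a Haar pair in a cell Q_p. Up to a null set the block P₁ ∪ P₂ is itself a
member A of the family, so x_A lies in one of the two halves. By (B), every x_B with B ⊇ P₁ ∪ P₂
that lies in the block equals x_A. The other half S_p is therefore new: it contains no point chosen
for a set that contains the block (`exists_new_half`).

Up to sign, evaluation at the indicator 1_{S_p} is the coordinate functional of the dipole of p.
That dipole has exactly one point in S_p. If the block of p lies in a half of q, the dipole of q has
no point in S_p: one point is excluded by newness, the other one is outside the block. In all other
positions of q ≠ p, S_p contains both points of q or neither (`mem_new_half`). The coordinate of the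
single Dirac mass is evaluation at 1.

The expansion converges absolutely. The dipole of p has norm at most C |Q_p|^s, since its two points
share Q_p and Haar coefficients of Dirac masses decay geometrically along a branch
(`enorm_dipole_le`). Moreover ∑_p |Q_p|^s |φ(1_{S_p})| is finite (`tsum_enorm_eval_block_ne_top`):
exchanging sums reduces this to a uniform bound for the constant and for single weighted wavelets
|Q_q|^(-s) φ_q. Only the p with Q_p ⊆ Q_q see φ_q, and the sum of |Q_p|^(1+s) over these p is at
most C |Q_q|^(1+s).

Since B^{-s}_{1,1} is isometric to ℂ ⊕ ℓ¹, the series has a sum σ, and all coordinates of φ - σ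
vanish. A functional that vanishes at a block and at one of its halves vanishes at the other half.
Descending the grid, φ - σ vanishes at all blocks, hence at all wavelets, so it is zero
(`eq_zero_of_eval_half`).

Choices with (A) and (B) are obtained by taking the least point of every set for a well-order of all
points. -/

/-! ### Combinatorics of iterated halving. -/

namespace IsHaarPair

variable {α : Type*}

theorem two_le_length {l S₁ S₂ : List α} (h : IsHaarPair l S₁ S₂) : 2 ≤ l.length := by
  obtain ⟨h1, h2, h3⟩ := h.tree
  have h4 := h3.length_le
  have h5 := List.length_pos_iff.2 h1
  have h6 := List.length_pos_iff.2 h2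
  rw [List.length_append] at h4
  omega

/-- A property of blocks that passes from a block to its two halves holds for all blocks. -/
theorem block_induction {C : List α → Prop} {l S₁ S₂ : List α} (h : IsHaarPair l S₁ S₂)
    (hl : C l) (hstep : ∀ T₁ T₂, IsHaarPair l T₁ T₂ → C (T₁ ++ T₂) → C T₁ ∧ C T₂) :
    C (S₁ ++ S₂) := by
  induction h with
  | halve l h => rwa [List.take_append_drop]
  | left l S₁ S₂ hS ih =>
    have h2 : 2 ≤ l.length := (IsHaarPair.left l S₁ S₂ hS).two_le_length
    exact ih (hstep _ _ (halve l h2) (by rwa [List.take_append_drop])).1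
      fun T₁ T₂ hT => hstep T₁ T₂ (hT.left _ _)
  | right l S₁ S₂ hS ih =>
    have h2 : 2 ≤ l.length := (IsHaarPair.right l S₁ S₂ hS).two_le_length
    exact ih (hstep _ _ (halve l h2) (by rwa [List.take_append_drop])).2
      fun T₁ T₂ hT => hstep T₁ T₂ (hT.right _ _)

/-- A property of blocks that passes from a block to its two halves holds for all blocks with
one element. -/
theorem singleton_induction {C : List α → Prop} {l : List α} (hl : C l)
    (hstep : ∀ T₁ T₂, IsHaarPair l T₁ T₂ → C (T₁ ++ T₂) → C T₁ ∧ C T₂) {a : α} (ha : a ∈ l) :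
    C [a] := by
  induction hn : l.length using Nat.strong_induction_on generalizing l with
  | _ n ih =>
    subst hn
    by_cases h : 2 ≤ l.length
    · obtain ⟨h1, h2⟩ := hstep _ _ (halve l h) (by rwa [List.take_append_drop])
      rw [← List.take_append_drop (l.length / 2) l, List.mem_append] at ha
      rcases ha with ha | ha
      · exact ih _ (by rw [List.length_take]; omega) h1
          (fun T₁ T₂ hT => hstep T₁ T₂ (hT.left _ _)) ha rfl
      · exact ih _ (by rw [List.length_drop]; omega) h2
          (fun T₁ T₂ hT => hstep T₁ T₂ (hT.right _ _)) ha rfl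
    · have h1 := List.length_pos_of_mem ha
      obtain ⟨b, rfl⟩ := List.length_eq_one_iff.1 (show l.length = 1 by omega)
      rwa [← List.mem_singleton.1 ha] at hl

/-- A block with `n` elements has at most `n - 1` Haar pairs. -/
theorem encard_le (l : List α) :
    {T : List α × List α | IsHaarPair l T.1 T.2}.encard ≤ (l.length - 1 : ℕ) := by
  induction hn : l.length using Nat.strong_induction_on generalizing l with
  | _ n ih =>
    subst hn
    by_cases h : 2 ≤ l.length
    · have hsub : {T : List α × List α | IsHaarPair l T.1 T.2} ⊆
          ({(l.take (l.length / 2), l.drop (l.length / 2))} ∪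
            {T : List α × List α | IsHaarPair (l.take (l.length / 2)) T.1 T.2}) ∪
            {T : List α × List α | IsHaarPair (l.drop (l.length / 2)) T.1 T.2} := by
        rintro ⟨T₁, T₂⟩ hT
        cases (hT : IsHaarPair l T₁ T₂) with
        | halve _ _ => exact Or.inl (Or.inl rfl)
        | left _ _ _ hT => exact Or.inl (Or.inr hT)
        | right _ _ _ hT => exact Or.inr hT
      have h1 := ih _ (by rw [List.length_take]; omega) (l.take (l.length / 2)) rfl
      have h2 := ih _ (by rw [List.length_drop]; omega) (l.drop (l.length / 2)) rfl
      refine (encard_le_encard hsub).trans ((encard_union_le _ _).trans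
        ((add_le_add ((encard_union_le _ _).trans (add_le_add (encard_singleton _).le h1))
          h2).trans ?_))
      -- Both halves are nonempty, so 1 + (m - 1) + (n - m - 1) = n - 1 holds for truncated
      -- subtraction too.
      rw [List.length_take, List.length_drop]
      norm_cast
      omega
    · have : {T : List α × List α | IsHaarPair l T.1 T.2} = ∅ :=
        eq_empty_of_forall_notMem fun T hT => h (two_le_length hT)
      rw [this]
      simp

end IsHaarPair

/-! ### Cells of a good grid up to null sets, and the decay of their measures. -/

namespace GoodGrid

variable {Ω : Type*} [MeasurableSpace Ω] {μ : Measure Ω}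

/-- The lower bound of the ratio of the measures of a child and of its father. -/
noncomputable def lowerRatio (G : GoodGrid μ) : ℝ := Classical.choose G.ratio

/-- The upper bound of the ratio of the measures of a child and of its father. -/
noncomputable def upperRatio (G : GoodGrid μ) : ℝ :=
  Classical.choose (Classical.choose_spec G.ratio).2

theorem lowerRatio_mem (G : GoodGrid μ) : G.lowerRatio ∈ Ioo (0 : ℝ) 1 :=
  (Classical.choose_spec G.ratio).1

theorem upperRatio_mem (G : GoodGrid μ) : G.upperRatio ∈ Ioo (0 : ℝ) 1 :=
  (Classical.choose_spec (Classical.choose_spec G.ratio).2).1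

/-- Cells of one level may overlap in null sets and inclusions hold only almost everywhere, so a
common part A of positive measure is what identifies two cells. -/
theorem eq_of_le_of_le (G : GoodGrid μ) {k : ℕ} {P Q A : Set Ω} (hP : P ∈ G.cells k)
    (hQ : Q ∈ G.cells k) (hA : 0 < μ.real A) (hAP : A ≤ᵐ[μ] P) (hAQ : A ≤ᵐ[μ] Q) : P = Q := by
  by_contra h
  have h1 : μ A ≤ μ (P ∩ Q) := by
    refine measure_mono_ae ?_
    filter_upwards [hAP, hAQ] with ω a b c
    exact ⟨a c, b c⟩
  rw [G.disjoint_cell k P hP Q hQ h] at h1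
  rw [measureReal_def, le_antisymm h1 zero_le, ENNReal.toReal_zero] at hA
  exact lt_irrefl _ hA

/-- Almost every point lies in exactly one cell of level `k`. -/
theorem ae_existsUnique (G : GoodGrid μ) (k : ℕ) :
    ∀ᵐ ω ∂μ, ∃ R ∈ G.cells k, ω ∈ R ∧ ∀ R' ∈ G.cells k, ω ∈ R' → R' = R := by
  have h1 : ∀ᵐ ω ∂μ, ω ∈ ⋃ Q ∈ G.cells k, Q := G.cover k
  have h2 : ∀ᵐ ω ∂μ, ∀ Q ∈ G.cells k, ∀ R ∈ G.cells k, Q ≠ R → ω ∉ Q ∩ R := by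
    rw [Finset.eventually_all]
    intro Q hQ
    rw [Finset.eventually_all]
    intro R hR
    by_cases h : Q = R
    · exact ae_of_all _ fun ω h' => absurd h h'
    · filter_upwards [measure_eq_zero_iff_ae_notMem.1 (G.disjoint_cell k Q hQ R hR h)] with ω hω _
      exact hω
  filter_upwards [h1, h2] with ω h1 h2
  obtain ⟨R, hR, hωR⟩ := mem_iUnion₂.1 h1
  refine ⟨R, hR, hωR, fun R' hR' hω => ?_⟩
  by_contra h
  exact h2 R' hR' R hR h ⟨hω, hωR⟩

theorem sum_measure_le (G : GoodGrid μ) {k : ℕ} (F : Finset (Set Ω)) {A : Set Ω}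
    (hF : ∀ R ∈ F, R ∈ G.cells k ∧ R ≤ᵐ[μ] A) : ∑ R ∈ F, μ R ≤ μ A := by
  rw [← measure_biUnion_finset₀ (f := fun R => R)
    (fun R hR R' hR' h => G.disjoint_cell k R (hF R hR).1 R' (hF R' hR').1 h)
    fun R hR => (G.measurable_cell k R (hF R hR).1).nullMeasurableSet]
  refine measure_mono_ae ?_
  have : ∀ᵐ ω ∂μ, ∀ R ∈ F, ω ∈ R → ω ∈ A := by
    rw [Finset.eventually_all]
    exact fun R hR => (hF R hR).2
  filter_upwards [this] with ω h hω
  obtain ⟨R, hR, hωR⟩ := mem_iUnion₂.1 hω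
  exact h R hR hωR

/-- `blockSum` counts multiplicities, but almost every point lies in only one cell of the level, and
that cell occurs at most once in the list. -/
theorem ae_blockSum (G : GoodGrid μ) {k : ℕ} {S : List (Set Ω)} (hnd : S.Nodup)
    (hS : ∀ R ∈ S, R ∈ G.cells k) :
    blockSum S =ᵐ[μ] (blockSet S).indicator fun _ => 1 := by
  classical
  filter_upwards [G.ae_existsUnique k] with ω h
  obtain ⟨R, hR, hωR, hu⟩ := h
  rw [blockSum, ← List.sum_toFinset _ hnd]
  have h1 : ∀ R' ∈ S, ω ∈ R' → R' = R := fun R' hR' => hu R' (hS R' hR')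
  by_cases hRS : R ∈ S
  · rw [Finset.sum_eq_single_of_mem R (List.mem_toFinset.2 hRS) fun R' hR' hne =>
        indicator_of_notMem (fun h => hne (h1 R' (List.mem_toFinset.1 hR') h)) _,
      indicator_of_mem hωR, indicator_of_mem]
    exact mem_iUnion₂.2 ⟨R, hRS, hωR⟩
  · rw [Finset.sum_eq_zero fun R' hR' => indicator_of_notMem (fun h => ?_) _,
      indicator_of_notMem]
    · intro h
      obtain ⟨R', hR', hωR'⟩ := mem_iUnion₂.1 h
      exact hRS (h1 R' hR' hωR' ▸ hR')
    · exact hRS (h1 R' (List.mem_toFinset.1 hR') h ▸ List.mem_toFinset.1 hR')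

/-- A cell that shares a set of positive measure with a cell of a lower level lies in it. -/
theorem le_of_le_of_le (G : GoodGrid μ) {k n : ℕ} (hkn : k ≤ n) {P Q A : Set Ω}
    (hP : P ∈ G.cells k) (hQ : Q ∈ G.cells n) (hA : 0 < μ.real A) (hAP : A ≤ᵐ[μ] P)
    (hAQ : A ≤ᵐ[μ] Q) : Q ≤ᵐ[μ] P := by
  obtain ⟨m, rfl⟩ := Nat.exists_eq_add_of_le hkn
  obtain ⟨P', hP', hQP'⟩ := G.ancestor k m Q hQ
  rwa [G.eq_of_le_of_le hP hP' hA hAP (hAQ.trans hQP')]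

variable [IsProbabilityMeasure μ]

theorem lowerRatio_mul_le (G : GoodGrid μ) {k : ℕ} {P Q : Set Ω} (hP : P ∈ G.cells k)
    (hQ : Q ∈ G.cells (k + 1)) (h : Q ≤ᵐ[μ] P) : G.lowerRatio * μ.real P ≤ μ.real Q :=
  (le_div_iff₀ (G.real_pos _ _ hP)).1
    ((Classical.choose_spec (Classical.choose_spec G.ratio).2).2 k P hP Q hQ h).1

theorem le_upperRatio_mul (G : GoodGrid μ) {k : ℕ} {P Q : Set Ω} (hP : P ∈ G.cells k)
    (hQ : Q ∈ G.cells (k + 1)) (h : Q ≤ᵐ[μ] P) : μ.real Q ≤ G.upperRatio * μ.real P :=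
  (div_le_iff₀ (G.real_pos _ _ hP)).1
    ((Classical.choose_spec (Classical.choose_spec G.ratio).2).2 k P hP Q hQ h).2

theorem real_le_pow_mul (G : GoodGrid μ) {k : ℕ} (n : ℕ) {P Q : Set Ω} (hP : P ∈ G.cells k)
    (hQ : Q ∈ G.cells (k + n)) (h : Q ≤ᵐ[μ] P) : μ.real Q ≤ G.upperRatio ^ n * μ.real P := by
  induction n generalizing Q with
  | zero =>
    rw [pow_zero, one_mul]
    exact ENNReal.toReal_mono (measure_ne_top _ _) (measure_mono_ae h)
  | succ n ih =>
    obtain ⟨R, hR, hQR⟩ := G.nested (k + n) Q hQ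
    have hRP := G.le_of_le_of_le (Nat.le_add_right k n) hP hR (G.real_pos _ _ hQ) h hQR
    refine (G.le_upperRatio_mul hR hQ hQR).trans ?_
    rw [pow_succ, mul_comm (G.upperRatio ^ n), mul_assoc]
    exact mul_le_mul_of_nonneg_left (ih hR hRP) G.upperRatio_mem.1.le

theorem blockMass_le (G : GoodGrid μ) {k : ℕ} {S : List (Set Ω)} {A : Set Ω} (hnd : S.Nodup)
    (hS : ∀ R ∈ S, R ∈ G.cells k ∧ R ≤ᵐ[μ] A) : blockMass μ S ≤ μ.real A := by
  classical
  rw [blockMass, ← List.sum_toFinset _ hnd]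
  have h := ENNReal.toReal_mono (measure_ne_top μ A) (G.sum_measure_le S.toFinset (k := k)
    fun R hR => hS R (List.mem_toFinset.1 hR))
  rwa [ENNReal.toReal_sum fun _ _ => measure_ne_top _ _] at h

end GoodGrid

/-! ### Induction along the grid, and points as branches of the grid. -/

section

namespace GoodGrid

variable {Ω : Type*} [MeasurableSpace Ω] {μ : Measure Ω} {G : GoodGrid μ}

theorem Point.seq_le (x : G.Point) {j k : ℕ} (h : j ≤ k) : x.seq k ≤ᵐ[μ] x.seq j := by
  induction k, h using Nat.le_induction with
  | base => exact EventuallyLE.rfl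
  | succ k _ ih => exact (x.seq_succ k).trans ih

namespace ChildOrder

variable (O : G.ChildOrder)

/-- Almost every ω ∈ Q lies in some cell R of the next level. The father of R contains ω as well, so
it is Q by uniqueness at level k. -/
theorem ae_blockSet_children {k : ℕ} {Q : Set Ω} (hQ : Q ∈ G.cells k) :
    blockSet (O.children k Q) =ᵐ[μ] Q := by
  have h1 : ∀ᵐ ω ∂μ, ∀ R ∈ G.cells (k + 1), ∃ P ∈ G.cells k, R ≤ᵐ[μ] P ∧ (ω ∈ R → ω ∈ P) := by
    rw [Finset.eventually_all]
    intro R hR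
    obtain ⟨P, hP, hRP⟩ := G.nested k R hR
    filter_upwards [hRP] with ω h
    exact ⟨P, hP, hRP, h⟩
  have h2 : ∀ᵐ ω ∂μ, ∀ R ∈ G.cells (k + 1), R ≤ᵐ[μ] Q → ω ∈ R → ω ∈ Q := by
    rw [Finset.eventually_all]
    intro R _
    by_cases h : R ≤ᵐ[μ] Q
    · filter_upwards [h] with ω h' _ using h'
    · exact ae_of_all _ fun ω h' => absurd h' h
  filter_upwards [h1, h2, G.ae_existsUnique (k + 1), G.ae_existsUnique k] with ω h1 h2 h3 h4
  refine propext ⟨fun h => ?_, fun h => ?_⟩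
  · obtain ⟨R, hR, hωR⟩ := mem_iUnion₂.1 h
    obtain ⟨hR1, hR2⟩ := (O.mem_children k Q hQ R).1 hR
    exact h2 R hR1 hR2 hωR
  · obtain ⟨R, hR, hωR, -⟩ := h3
    obtain ⟨P, hP, hRP, hP'⟩ := h1 R hR
    obtain ⟨P', -, -, hu⟩ := h4
    have : P = Q := (hu P hP (hP' hωR)).trans (hu Q hQ h).symm
    exact mem_iUnion₂.2 ⟨R, (O.mem_children k Q hQ R).2 ⟨hR, this ▸ hRP⟩, hωR⟩

/-- A property of blocks of cells that passes from cells to the blocks of their children, and from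
a block to its two halves, holds for all cells and for all blocks. -/
theorem cell_induction {C : ℕ → List (Set Ω) → Prop} (h0 : C 0 [univ])
    (hcell : ∀ k, ∀ Q ∈ G.cells k, C k [Q] → C (k + 1) (O.children k Q))
    (hstep : ∀ p : HaarPair O, C (p.level + 1) (p.fst ++ p.snd) →
      C (p.level + 1) p.fst ∧ C (p.level + 1) p.snd) :
    ∀ k, ∀ Q ∈ G.cells k, C k [Q] := by
  intro k
  induction k with
  | zero =>
    intro Q hQ
    rw [G.cells_zero, Finset.mem_singleton] at hQ
    rwa [hQ]
  | succ k ih =>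
    intro Q hQ
    obtain ⟨P, hP, hQP⟩ := G.nested k Q hQ
    exact IsHaarPair.singleton_induction (C := C (k + 1)) (hcell k P hP (ih P hP))
      (fun T₁ T₂ hT => hstep ⟨k, P, T₁, T₂, hP, hT⟩)
      ((O.mem_children k P hP Q).2 ⟨hQ, hQP⟩)

/-- This is the descent from the whole space to an arbitrary block. It yields that every halved
block belongs to the family, that indicators of blocks are test functions, and that a functional
with vanishing coordinates vanishes at all blocks. -/
theorem block_induction {C : ℕ → List (Set Ω) → Prop} (h0 : C 0 [univ])
    (hcell : ∀ k, ∀ Q ∈ G.cells k, C k [Q] → C (k + 1) (O.children k Q))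
    (hstep : ∀ p : HaarPair O, C (p.level + 1) (p.fst ++ p.snd) →
      C (p.level + 1) p.fst ∧ C (p.level + 1) p.snd) (p : HaarPair O) :
    C (p.level + 1) (p.fst ++ p.snd) ∧ C (p.level + 1) p.fst ∧ C (p.level + 1) p.snd := by
  have h := p.isHaarPair.block_induction (C := C (p.level + 1))
    (hcell _ _ p.cell_mem (O.cell_induction h0 hcell hstep _ _ p.cell_mem))
    (fun T₁ T₂ hT => hstep ⟨p.level, p.cell, T₁, T₂, p.cell_mem, hT⟩)
  exact ⟨h, hstep p h⟩

variable [IsProbabilityMeasure μ]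

theorem children_ne_nil {k : ℕ} {Q : Set Ω} (hQ : Q ∈ G.cells k) : O.children k Q ≠ [] := by
  intro h
  have h1 := O.ae_blockSet_children hQ
  have h2 := G.real_pos k Q hQ
  rw [h] at h1
  rw [← measureReal_congr h1] at h2
  simp [blockSet] at h2

/-- The number of children is bounded. -/
theorem length_children_le {k : ℕ} {Q : Set Ω} (hQ : Q ∈ G.cells k) :
    (O.children k Q).length ≤ ⌈G.lowerRatio⁻¹⌉₊ := by
  have h1 := G.blockMass_le (O.nodup k Q hQ) fun R hR => (O.mem_children k Q hQ R).1 hR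
  have h2 : ((O.children k Q).length : ℝ) * (G.lowerRatio * μ.real Q) ≤
      blockMass μ (O.children k Q) := by
    rw [blockMass, ← nsmul_eq_mul, ← List.length_map (fun R => μ.real R)]
    refine List.card_nsmul_le_sum _ _ fun x hx => ?_
    obtain ⟨R, hR, rfl⟩ := List.mem_map.1 hx
    obtain ⟨hR1, hR2⟩ := (O.mem_children k Q hQ R).1 hR
    exact G.lowerRatio_mul_le hQ hR1 hR2
  have h3 := G.real_pos k Q hQ
  have h4 := G.lowerRatio_mem.1
  refine Nat.cast_le.1 ((?_ : ((O.children k Q).length : ℝ) ≤ G.lowerRatio⁻¹).trans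
    (Nat.le_ceil _))
  rw [← one_div, le_div_iff₀ h4]
  refine le_of_mul_le_mul_right ?_ h3
  linarith

/-- Every cell contains a point. -/
theorem exists_point_of_cell (O : G.ChildOrder) {n : ℕ} {R : Set Ω} (hR : R ∈ G.cells n) :
    ∃ x : G.Point, x.seq n = R := by
  have hchild : ∀ (m : ℕ) (Q : G.cells m), ∃ Q' : G.cells (m + 1), Q'.1 ≤ᵐ[μ] Q.1 := by
    rintro m ⟨Q, hQ⟩
    obtain ⟨Q', hQ'⟩ := List.exists_mem_of_ne_nil _ (O.children_ne_nil hQ)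
    obtain ⟨h1, h2⟩ := (O.mem_children m Q hQ Q').1 hQ'
    exact ⟨⟨Q', h1⟩, h2⟩
  choose f hf using hchild
  let g : ∀ j, G.cells (n + j) := fun j =>
    Nat.rec (motive := fun j => G.cells (n + j)) ⟨R, hR⟩ (fun j Q => f (n + j) Q) j
  have hg : ∀ j, (g (j + 1)).1 ≤ᵐ[μ] (g j).1 := fun j => hf _ _
  -- The branch consists of the ancestors at level j of the cells `g j` of level n + j. This covers
  -- the levels above and below R at once; at level n the ancestor is R itself.
  have hg' : ∀ j, ∃ P ∈ G.cells j, (g j).1 ≤ᵐ[μ] P := fun j =>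
    G.ancestor j n _ (by rw [add_comm]; exact (g j).2)
  choose a ha hga using hg'
  have hpos : ∀ j, 0 < μ.real (g j).1 := fun j => G.real_pos _ _ (g j).2
  refine ⟨⟨a, ?_, ha, fun j => ?_⟩, ?_⟩
  · have := ha 0
    rwa [G.cells_zero, Finset.mem_singleton] at this
  · exact G.le_of_le_of_le (Nat.le_succ j) (ha j) (ha (j + 1)) (hpos (j + 1))
      ((hg j).trans (hga j)) (hga (j + 1))
  · have h1 : ∀ j, (g j).1 ≤ᵐ[μ] R := by
      intro j
      induction j with
      | zero => exact EventuallyLE.rfl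
      | succ j ih => exact (hg j).trans ih
    exact G.eq_of_le_of_le (ha n) hR (hpos n) (hga n) (h1 n)

end ChildOrder

/-! ### Membership of points in blocks, and existence of dipole choices. -/

theorem Point.isIn_univ (x : G.Point) : x.IsIn univ := ⟨0, ae_of_all _ fun _ _ => trivial⟩

theorem Point.IsIn.mono {x : G.Point} {A B : Set Ω} (h : x.IsIn A) (hAB : A ≤ᵐ[μ] B) :
    x.IsIn B :=
  h.imp fun _ h => h.trans hAB

variable [IsProbabilityMeasure μ]

/-- This turns an almost everywhere inclusion at an unknown level into membership in a list at level
n. If some cell of the branch lies in the block, then so does its cell of level max j n. That cell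
has positive measure and lies in `x.seq n`, which must therefore be one of the cells of S. -/
theorem Point.isIn_blockSet_iff (x : G.Point) {n : ℕ} {S : List (Set Ω)}
    (hS : ∀ R ∈ S, R ∈ G.cells n) : x.IsIn (blockSet S) ↔ x.seq n ∈ S := by
  constructor
  · rintro ⟨j, hj⟩
    by_contra hn
    have h1 : ∀ᵐ ω ∂μ, ω ∈ x.seq (max j n) → ω ∈ blockSet S := (x.seq_le (le_max_left j n)).trans hj
    have h2 : ∀ᵐ ω ∂μ, ω ∈ x.seq (max j n) → ω ∈ x.seq n := x.seq_le (le_max_right j n)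
    have h3 : ∀ᵐ ω ∂μ, ω ∉ x.seq (max j n) := by
      filter_upwards [h1, h2, G.ae_existsUnique n] with ω h1 h2 h3 hω
      obtain ⟨R, -, -, hu⟩ := h3
      obtain ⟨R', hR', hωR'⟩ := mem_iUnion₂.1 (h1 hω)
      exact hn ((hu _ (x.seq_mem n) (h2 hω)).trans (hu R' (hS R' hR') hωR').symm ▸ hR')
    have h4 := G.real_pos _ _ (x.seq_mem (max j n))
    rw [measureReal_def, measure_eq_zero_iff_ae_notMem.2 h3] at h4
    simp at h4
  · intro h
    exact ⟨n, ae_of_all _ fun ω hω => mem_iUnion₂.2 ⟨_, h, hω⟩⟩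

/-- Choose in every set of the family the first point for some well-order. -/
theorem ChildOrder.exists_isDipoleChoice (O : G.ChildOrder) :
    ∃ x : O.family → G.Point, O.IsDipoleChoice x := by
  have hne : ∀ A : O.family, ∃ x : G.Point, x.IsIn A.1 := by
    have key : ∀ {n : ℕ} {S : List (Set Ω)}, S ≠ [] → (∀ R ∈ S, R ∈ G.cells n) →
        ∃ x : G.Point, x.IsIn (blockSet S) := by
      intro n S h0 hS
      obtain ⟨R, hR⟩ := List.exists_mem_of_ne_nil _ h0
      obtain ⟨x, hx⟩ := O.exists_point_of_cell (hS R hR)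
      exact ⟨x, (x.isIn_blockSet_iff hS).2 (hx ▸ hR)⟩
    rintro ⟨A, rfl | ⟨p, rfl | rfl⟩⟩
    · obtain ⟨x, -⟩ := O.exists_point_of_cell (n := 0) (R := univ) (by simp [G.cells_zero])
      exact ⟨x, x.isIn_univ⟩
    · exact key p.isHaarPair.tree.1 fun R hR => (p.mem_cells (List.mem_append_left _ hR)).1
    · exact key p.isHaarPair.tree.2.1 fun R hR => (p.mem_cells (List.mem_append_right _ hR)).1
  have wf : WellFounded (WellOrderingRel : G.Point → G.Point → Prop) :=
    IsWellFounded.wf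
  choose x hx hmin using fun A : O.family => wf.has_min {x | x.IsIn A.1} (hne A)
  refine ⟨x, hx, fun A B hAB h => ?_⟩
  -- As x_A lies in B, it is not smaller than x_B; as x_B lies in A, it is not smaller than x_A.
  exact ((trichotomous_of WellOrderingRel _ _).resolve_left
    (hmin B _ ((hx A : Point.IsIn _ _).mono hAB))).resolve_right (hmin A _ h)

end GoodGrid

end

/-! ### Sums over Haar pairs and geometric series. -/

section

variable {Ω : Type*} [MeasurableSpace Ω] {μ : Measure Ω} {G : GoodGrid μ}

/-- Haar pairs, sorted by level and cell. -/
def haarPairEquiv (O : G.ChildOrder) : HaarPair O ≃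
    Σ (k : ℕ) (Q : G.cells k),
      {T : List (Set Ω) × List (Set Ω) | IsHaarPair (O.children k Q) T.1 T.2} where
  toFun p := ⟨p.level, ⟨p.cell, p.cell_mem⟩, ⟨(p.fst, p.snd), p.isHaarPair⟩⟩
  invFun t := ⟨t.1, t.2.1, t.2.2.1.1, t.2.2.1.2, t.2.1.2, t.2.2.2⟩
  left_inv _ := rfl
  right_inv _ := rfl

/-- A constant that bounds sums over all Haar pairs by a geometric series. -/
noncomputable def haarConst (G : GoodGrid μ) (s : ℝ) : ℝ≥0∞ :=
  (⌈G.lowerRatio⁻¹⌉₊ : ℝ≥0∞) * (1 - ENNReal.ofReal (G.upperRatio ^ s))⁻¹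

/-- Positivity of s makes the ratio λ^s of the geometric series smaller than 1. -/
theorem haarConst_ne_top (G : GoodGrid μ) {s : ℝ} (hs : 0 < s) : haarConst G s ≠ ∞ := by
  refine ENNReal.mul_ne_top (ENNReal.natCast_ne_top _) (ENNReal.inv_ne_top.2 ?_)
  have h := Real.rpow_lt_one G.upperRatio_mem.1.le G.upperRatio_mem.2 hs
  exact (tsub_pos_of_lt (ENNReal.ofReal_lt_one.2 h)).ne'

variable [IsProbabilityMeasure μ]

/-- A cell carries fewer Haar pairs than it has children, and it has at most 1/λ_* children, each
having at least the fraction λ_* of its mass. -/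
theorem tsum_haarPair_le (O : G.ChildOrder) (w : ℕ → Set Ω → ℝ≥0∞) :
    ∑' p : HaarPair O, w p.level p.cell ≤
      (⌈G.lowerRatio⁻¹⌉₊ : ℝ≥0∞) * ∑' k, ∑ Q ∈ G.cells k, w k Q := by
  rw [← (haarPairEquiv O).symm.tsum_eq, ENNReal.tsum_sigma', ← ENNReal.tsum_mul_left]
  refine ENNReal.tsum_le_tsum fun k => ?_
  rw [ENNReal.tsum_sigma', Finset.mul_sum, ← Finset.sum_coe_sort, tsum_fintype]
  refine Finset.sum_le_sum fun Q _ => ?_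
  change ∑' _ : {T : List (Set Ω) × List (Set Ω) | IsHaarPair (O.children k Q) T.1 T.2},
    w k Q ≤ _
  rw [ENNReal.tsum_set_const]
  refine mul_le_mul_left ?_ _
  have h1 := IsHaarPair.encard_le (O.children k Q)
  have h2 := O.length_children_le Q.2
  have h3 : ((O.children k Q).length - 1 : ℕ) ≤ ⌈G.lowerRatio⁻¹⌉₊ := by omega
  have h4 := h1.trans (Nat.cast_le.2 h3 : (((O.children k Q).length - 1 : ℕ) : ℕ∞) ≤ _)
  simpa using ENat.toENNReal_le.2 h4

/-- Common frame for two sums: |Q|^s along a branch, which controls Dirac masses, and |Q|^(1+s) over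
the cells below a given one, which controls the coordinates. -/
theorem tsum_haarPair_le_geometric (O : G.ChildOrder) (s : ℝ) (n : ℕ) (M : ℝ≥0∞)
    (w : ℕ → Set Ω → ℝ≥0∞) (h0 : ∀ k < n, ∀ Q, w k Q = 0)
    (h : ∀ i, ∑ Q ∈ G.cells (n + i), w (n + i) Q ≤ ENNReal.ofReal (G.upperRatio ^ s) ^ i * M) :
    ∑' p : HaarPair O, w p.level p.cell ≤ haarConst G s * M := by
  refine (tsum_haarPair_le O w).trans ?_
  rw [haarConst, mul_assoc]
  refine mul_le_mul_right ?_ _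
  -- The levels below n contribute nothing, so the series starts at level n.
  rw [← (add_right_injective n).tsum_eq (f := fun k => ∑ Q ∈ G.cells k, w k Q)]
  · rw [← ENNReal.tsum_geometric, ← ENNReal.tsum_mul_right]
    exact ENNReal.tsum_le_tsum h
  · intro k hk
    by_contra hn
    refine hk (Finset.sum_eq_zero fun Q _ => h0 k (not_le.1 fun h' => hn ?_) Q)
    exact ⟨k - n, by simp only; omega⟩

theorem GoodGrid.rpow_le_pow_mul (G : GoodGrid μ) {s : ℝ} (hs : 0 < s) {n i : ℕ} {P Q : Set Ω}
    (hP : P ∈ G.cells n) (hQ : Q ∈ G.cells (n + i)) (h : Q ≤ᵐ[μ] P) :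
    ENNReal.ofReal (μ.real Q ^ s) ≤
      ENNReal.ofReal (G.upperRatio ^ s) ^ i * ENNReal.ofReal (μ.real P ^ s) := by
  have h0 := G.upperRatio_mem.1.le
  rw [← ENNReal.ofReal_pow (Real.rpow_nonneg h0 _), ← ENNReal.ofReal_mul (by positivity),
    ← Real.rpow_natCast, ← Real.rpow_mul h0, mul_comm s, Real.rpow_mul h0, Real.rpow_natCast,
    ← Real.mul_rpow (by positivity) measureReal_nonneg]
  exact ENNReal.ofReal_le_ofReal
    (Real.rpow_le_rpow measureReal_nonneg (G.real_le_pow_mul i hP hQ h) hs.le)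

open scoped Classical in
/-- The sum over the Haar pairs along a branch of the grid. -/
theorem tsum_haarPair_seq_le (O : G.ChildOrder) {s : ℝ} (hs : 0 < s) (x : G.Point) (n : ℕ) :
    ∑' p : HaarPair O, (if n ≤ p.level ∧ p.cell = x.seq p.level
      then ENNReal.ofReal (μ.real p.cell ^ s) else 0) ≤
      haarConst G s * ENNReal.ofReal (μ.real (x.seq n) ^ s) := by
  refine tsum_haarPair_le_geometric O s n _ (fun k Q => if n ≤ k ∧ Q = x.seq k
    then ENNReal.ofReal (μ.real Q ^ s) else 0) (fun k hk Q => if_neg fun h => ?_) fun i => ?_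
  · exact absurd h.1 (not_le.2 hk)
  -- A branch has a single cell at every level.
  · rw [Finset.sum_eq_single_of_mem _ (x.seq_mem (n + i)) fun Q _ hQ => if_neg fun h => hQ h.2]
    rw [if_pos ⟨Nat.le_add_right _ _, rfl⟩]
    exact G.rpow_le_pow_mul hs (x.seq_mem n) (x.seq_mem _) (x.seq_le (Nat.le_add_right _ _))

open scoped Classical in
/-- The sum over the Haar pairs below a cell. -/
theorem tsum_haarPair_below_le (O : G.ChildOrder) {s : ℝ} (hs : 0 < s) {n : ℕ} {P : Set Ω}
    (hP : P ∈ G.cells n) :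
    ∑' p : HaarPair O, (if n ≤ p.level ∧ p.cell ≤ᵐ[μ] P
      then ENNReal.ofReal (μ.real p.cell ^ s) * μ p.cell else 0) ≤
      haarConst G s * (ENNReal.ofReal (μ.real P ^ s) * μ P) := by
  refine tsum_haarPair_le_geometric O s n _ (fun k Q => if n ≤ k ∧ Q ≤ᵐ[μ] P
    then ENNReal.ofReal (μ.real Q ^ s) * μ Q else 0) (fun k hk Q => if_neg fun h => ?_)
    fun i => ?_
  · exact absurd h.1 (not_le.2 hk)
  · simp only [Nat.le_add_right, true_and]
    rw [← Finset.sum_filter]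
    -- Only the factor |Q|^s decays with the level; the masses of the cells of one level inside P
    -- add up to at most |P|.
    refine (Finset.sum_le_sum (g := fun Q => ENNReal.ofReal (G.upperRatio ^ s) ^ i *
      ENNReal.ofReal (μ.real P ^ s) * μ Q) fun Q hQ => ?_).trans ?_
    · obtain ⟨h1, h2⟩ := Finset.mem_filter.1 hQ
      exact mul_le_mul_left (G.rpow_le_pow_mul hs hP h1 h2) _
    · rw [← Finset.mul_sum, ← mul_assoc]
      exact mul_le_mul_right (G.sum_measure_le _ fun Q hQ => Finset.mem_filter.1 hQ) _

/-! ### Integrals of wavelets over cells. -/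

namespace HaarPair

variable {O : G.ChildOrder}

/-- The square of the `L²` norm of the wavelet. -/
noncomputable def sqNorm (p : HaarPair O) : ℝ :=
  1 / blockMass μ p.fst + 1 / blockMass μ p.snd

theorem sqNorm_pos (p : HaarPair O) : 0 < p.sqNorm :=
  add_pos (one_div_pos.2 p.blockMass_fst_pos) (one_div_pos.2 p.blockMass_snd_pos)

open scoped Classical in
theorem setIntegral_wavelet_fst (p : HaarPair O) {R A : Set Ω} (hR : R ∈ p.fst)
    (hA : A ≤ᵐ[μ] R) :
    ∫ ω in A, p.wavelet ω ∂μ = (1 / (blockMass μ p.fst : ℂ)) * (μ.real A : ℂ) := by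
  rw [p.setIntegral_wavelet_of_le (p.mem_cells (List.mem_append_left _ hR)).1 hA,
    List.count_eq_one_of_mem (List.nodup_append.1 p.nodup_append).1 hR,
    List.count_eq_zero_of_not_mem (List.disjoint_of_nodup_append p.nodup_append hR)]
  simp

open scoped Classical in
theorem setIntegral_wavelet_snd (p : HaarPair O) {R A : Set Ω} (hR : R ∈ p.snd)
    (hA : A ≤ᵐ[μ] R) :
    ∫ ω in A, p.wavelet ω ∂μ = (-(1 / (blockMass μ p.snd : ℂ))) * (μ.real A : ℂ) := by
  rw [p.setIntegral_wavelet_of_le (p.mem_cells (List.mem_append_right _ hR)).1 hA,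
    List.count_eq_one_of_mem (List.nodup_append.1 p.nodup_append).2.1 hR,
    List.count_eq_zero_of_not_mem
      fun h' => List.disjoint_of_nodup_append p.nodup_append h' hR]
  simp

theorem integral_wavelet_mul_self (p : HaarPair O) :
    ∫ ω, p.wavelet ω * p.wavelet ω ∂μ = (p.sqNorm : ℂ) := by
  have h1 : (blockMass μ p.fst : ℂ) ≠ 0 := by exact_mod_cast p.blockMass_fst_pos.ne'
  have h2 : (blockMass μ p.snd : ℂ) ≠ 0 := by exact_mod_cast p.blockMass_snd_pos.ne'
  rw [p.integral_mul_wavelet p.integrable_wavelet,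
    sum_mul_blockMass fun R hR => p.setIntegral_wavelet_fst hR EventuallyLE.rfl,
    sum_mul_blockMass fun R hR => p.setIntegral_wavelet_snd hR EventuallyLE.rfl, sqNorm]
  push_cast
  field_simp
  ring

/-- The integral of a wavelet over a cell of a higher level. -/
theorem norm_setIntegral_wavelet_le (p : HaarPair O) {n : ℕ} (hn : p.level < n) {A : Set Ω}
    (hA : A ∈ G.cells n) : ‖∫ ω in A, p.wavelet ω ∂μ‖ ≤ p.sqNorm * μ.real A ∧
      (¬ A ≤ᵐ[μ] p.cell → ∫ ω in A, p.wavelet ω ∂μ = 0) := by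
  classical
  obtain ⟨m, rfl⟩ := Nat.exists_eq_add_of_le (Nat.succ_le_of_lt hn)
  -- The wavelet is almost everywhere constant on R, the ancestor of A at the level of the children.
  obtain ⟨R, hR, hAR⟩ := G.ancestor (p.level + 1) m A hA
  have hm1 := one_div_pos.2 p.blockMass_fst_pos
  have hm2 := one_div_pos.2 p.blockMass_snd_pos
  by_cases h1 : R ∈ p.fst
  · refine ⟨?_, fun h => absurd (hAR.trans (p.mem_cells (List.mem_append_left _ h1)).2) h⟩
    rw [p.setIntegral_wavelet_fst h1 hAR, norm_mul, Complex.norm_of_nonneg measureReal_nonneg]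
    refine mul_le_mul_of_nonneg_right ?_ measureReal_nonneg
    rw [sqNorm, ← Complex.ofReal_one, ← Complex.ofReal_div, Complex.norm_of_nonneg hm1.le]
    linarith
  by_cases h2 : R ∈ p.snd
  · refine ⟨?_, fun h => absurd (hAR.trans (p.mem_cells (List.mem_append_right _ h2)).2) h⟩
    rw [p.setIntegral_wavelet_snd h2 hAR, norm_mul, Complex.norm_of_nonneg measureReal_nonneg]
    refine mul_le_mul_of_nonneg_right ?_ measureReal_nonneg
    rw [sqNorm, norm_neg, ← Complex.ofReal_one, ← Complex.ofReal_div,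
      Complex.norm_of_nonneg hm2.le]
    linarith
  · have h : ∫ ω in A, p.wavelet ω ∂μ = 0 := by
      rw [p.setIntegral_wavelet_of_le hR hAR, List.count_eq_zero_of_not_mem h1,
        List.count_eq_zero_of_not_mem h2]
      simp
    rw [h, norm_zero]
    exact ⟨mul_nonneg p.sqNorm_pos.le measureReal_nonneg, fun _ => rfl⟩

/-- The integral of a wavelet over a cell of the same or of a lower level vanishes. -/
theorem setIntegral_wavelet_eq_zero (p : HaarPair O) {n : ℕ} (hn : n ≤ p.level) {A : Set Ω}
    (hA : A ∈ G.cells n) : ∫ ω in A, p.wavelet ω ∂μ = 0 := by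
  classical
  obtain ⟨m, hm⟩ := Nat.exists_eq_add_of_le hn
  obtain ⟨P, hP, hpP⟩ := G.ancestor n m p.cell (hm ▸ p.cell_mem)
  have hAm := G.measurable_cell n A hA
  -- The indicator of A has the same mean on all the cells of p: 1 if A is the ancestor P of
  -- `p.cell` at level n, and 0 otherwise.
  have h := p.integral_mul_wavelet_eq_zero (f := A.indicator fun _ => (1 : ℂ))
    (κ := if A = P then 1 else 0) ((integrable_const _).indicator hAm) fun R hR => by
      rw [integral_indicator hAm, setIntegral_const,
        measureReal_restrict_apply' (G.measurable_cell _ R (p.mem_cells hR).1),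
        G.real_inter hA hP ((p.mem_cells hR).2.trans hpP)]
      split_ifs <;> simp
  rw [← h, ← integral_indicator hAm]
  congr 1
  ext ω
  by_cases hω : ω ∈ A <;> simp [hω]

/-- Each half contains at least one child, so its mass is at least λ_* |Q|. -/
theorem real_mul_sqNorm_le (p : HaarPair O) : μ.real p.cell * p.sqNorm ≤ 2 / G.lowerRatio := by
  have key : ∀ S : List (Set Ω), S ≠ [] → (∀ R ∈ S, R ∈ p.fst ++ p.snd) →
      G.lowerRatio * μ.real p.cell ≤ blockMass μ S := by
    intro S h0 hS
    cases S with
    | nil => exact absurd rfl h0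
    | cons R S =>
      obtain ⟨h1, h2⟩ := p.mem_cells (hS R (by simp))
      have h3 := G.lowerRatio_mul_le p.cell_mem h1 h2
      have h4 : 0 ≤ (S.map fun R => μ.real R).sum := List.sum_nonneg (by
        intro x hx
        obtain ⟨R', -, rfl⟩ := List.mem_map.1 hx
        exact measureReal_nonneg)
      rw [blockMass, List.map_cons, List.sum_cons]
      linarith
  have h1 := key p.fst p.isHaarPair.tree.1 fun R hR => List.mem_append_left _ hR
  have h2 := key p.snd p.isHaarPair.tree.2.1 fun R hR => List.mem_append_right _ hR
  have h3 := G.real_pos _ _ p.cell_mem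
  have h4 := G.lowerRatio_mem.1
  have h5 : 0 < G.lowerRatio * μ.real p.cell := mul_pos h4 h3
  have h6 := one_div_le_one_div_of_le h5 h1
  have h7 := one_div_le_one_div_of_le h5 h2
  calc μ.real p.cell * p.sqNorm ≤ μ.real p.cell * (1 / (G.lowerRatio * μ.real p.cell) +
        1 / (G.lowerRatio * μ.real p.cell)) := by
        unfold sqNorm
        gcongr
    _ = 2 / G.lowerRatio := by
        field_simp
        ring

end HaarPair

end

/-! ### The duality pairing in Haar coefficients, and completeness of B^{-s}_{1,1}. -/

section

variable {Ω : Type*} [MeasurableSpace Ω] {μ : Measure Ω} [IsProbabilityMeasure μ]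
  {G : GoodGrid μ} {O : G.ChildOrder} {s : ℝ}

theorem HaarPair.rpow_mul_rpow_neg (p : HaarPair O) (s : ℝ) :
    ((μ.real p.cell ^ s : ℝ) : ℂ) * ((μ.real p.cell ^ (-s) : ℝ) : ℂ) = 1 := by
  rw [← Complex.ofReal_mul, ← Real.rpow_add (G.real_pos _ _ p.cell_mem), add_neg_cancel,
    Real.rpow_zero, Complex.ofReal_one]

theorem HaarPair.rpow_one_add (p : HaarPair O) (s : ℝ) :
    ((μ.real p.cell ^ (1 + s) : ℝ) : ℂ) = (μ.real p.cell : ℂ) * ((μ.real p.cell ^ s : ℝ) : ℂ) := by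
  rw [← Complex.ofReal_mul, Real.rpow_add (G.real_pos _ _ p.cell_mem), Real.rpow_one]

namespace BesovPos

theorem constCoeff_eq (ψ : BesovPos O s) : ψ.constCoeff = ∫ ω, ψ.toLp ω ∂μ :=
  ψ.hasHaarSeries.const_eq

theorem integral_mul_wavelet (ψ : BesovPos O s) (p : HaarPair O) :
    ∫ ω, ψ.toLp ω * p.wavelet ω ∂μ =
      ((μ.real p.cell ^ (1 + s) : ℝ) : ℂ) * ψ.coeff p * (p.sqNorm : ℂ) := by
  rw [← ψ.hasHaarSeries.coeff_eq p, p.integral_wavelet_mul_self]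

/-- The weights |Q|^(1+s) and |Q|^(-s) of the two spaces leave the factor |Q| ‖φ_p‖², which is
bounded by 2/λ_* uniformly in p. The duality is thus that of bounded and summable sequences with
bounded weights. -/
theorem rpow_neg_mul_integral (ψ : BesovPos O s) (p : HaarPair O) :
    ((μ.real p.cell ^ (-s) : ℝ) : ℂ) * ∫ ω, ψ.toLp ω * p.wavelet ω ∂μ =
      ((μ.real p.cell * p.sqNorm : ℝ) : ℂ) * ψ.coeff p := by
  rw [ψ.integral_mul_wavelet, p.rpow_one_add]
  have h := p.rpow_mul_rpow_neg s
  push_cast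
  linear_combination (μ.real p.cell : ℂ) * ψ.coeff p * p.sqNorm * h

theorem norm_constCoeff_le (ψ : BesovPos O s) : ‖ψ.constCoeff‖ ≤ ‖ψ‖ := by
  rw [norm_def]
  linarith [Real.iSup_nonneg fun p => norm_nonneg (ψ.coeff p)]

theorem norm_coeff_le (ψ : BesovPos O s) (p : HaarPair O) : ‖ψ.coeff p‖ ≤ ‖ψ‖ := by
  rw [norm_def]
  linarith [le_ciSup ψ.hasHaarSeries.1 p, norm_nonneg ψ.constCoeff]

theorem norm_rpow_neg_mul_integral_le (ψ : BesovPos O s) (p : HaarPair O) :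
    ‖((μ.real p.cell ^ (-s) : ℝ) : ℂ) * ∫ ω, ψ.toLp ω * p.wavelet ω ∂μ‖ ≤
      2 / G.lowerRatio * ‖ψ‖ := by
  rw [rpow_neg_mul_integral, norm_mul, Complex.norm_of_nonneg
    (mul_nonneg measureReal_nonneg p.sqNorm_pos.le)]
  have := G.lowerRatio_mem.1
  exact mul_le_mul p.real_mul_sqNorm_le (ψ.norm_coeff_le p) (norm_nonneg _) (by positivity)

/-- The Haar series of a function can be integrated over measurable sets. -/
theorem hasSum_setIntegral (ψ : BesovPos O s) {A : Set Ω} (hA : MeasurableSet A) :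
    HasSum (fun p : HaarPair O => ((μ.real p.cell ^ (1 + s) : ℝ) : ℂ) * ψ.coeff p *
      ∫ ω in A, p.wavelet ω ∂μ) (∫ ω in A, ψ.toLp ω ∂μ - (∫ ω, ψ.toLp ω ∂μ) * μ.real A) := by
  have hm : MemLp (A.indicator fun _ => (1 : ℂ)) 1 μ := (memLp_const 1).indicator hA
  have hi : ∀ f : Ω → ℂ, ∫ ω, f ω * A.indicator (fun _ => (1 : ℂ)) ω ∂μ = ∫ ω in A, f ω ∂μ := by
    intro f
    rw [← integral_indicator hA]
    congr 1
    ext ω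
    by_cases hω : ω ∈ A <;> simp [hω]
  have h := ψ.hasHaarSeries.2.mapL (integralMul μ _ hm)
  simp only [map_sub, map_smul, integralMul_apply, integral_waveletLp_mul,
    integral_const_mul_Lp] at h
  simp only [hi, integral_indicator hA, smul_eq_mul, setIntegral_const, constCoeff_eq,
    Complex.real_smul, mul_one] at h
  exact h

end BesovPos

/-- The functional with given Haar coefficients. -/
noncomputable def dualOfCoeff (s : ℝ) (d : ℂ) {b : HaarPair O → ℂ}
    (hb : Summable fun p => ‖b p‖) : StrongDual ℂ (BesovPos O s) :=
  have hsum : ∀ ψ : BesovPos O s, Summable fun p : HaarPair O =>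
      b p * (((μ.real p.cell * p.sqNorm : ℝ) : ℂ) * ψ.coeff p) := fun ψ =>
    (hb.mul_right (2 / G.lowerRatio * ‖ψ‖)).of_norm_bounded fun p => by
      rw [norm_mul, ← ψ.rpow_neg_mul_integral]
      exact mul_le_mul_of_nonneg_left (ψ.norm_rpow_neg_mul_integral_le p) (norm_nonneg _)
  LinearMap.mkContinuous
    { toFun := fun ψ => d * ψ.constCoeff +
        ∑' p : HaarPair O, b p * (((μ.real p.cell * p.sqNorm : ℝ) : ℂ) * ψ.coeff p)
      map_add' := fun ψ ψ' => by
        rw [(BesovPos.coeff_add ψ ψ').1, (BesovPos.coeff_add ψ ψ').2, add_add_add_comm,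
          ← (hsum ψ).tsum_add (hsum ψ'), mul_add]
        congr 2
        ext p
        rw [Pi.add_apply]
        ring
      map_smul' := fun z ψ => by
        rw [(BesovPos.coeff_smul z ψ).1, (BesovPos.coeff_smul z ψ).2, RingHom.id_apply, smul_add,
          smul_eq_mul z (tsum _), ← tsum_mul_left, mul_smul_comm]
        congr 2
        ext p
        rw [Pi.smul_apply, smul_eq_mul]
        ring }
    (‖d‖ + (∑' p, ‖b p‖) * (2 / G.lowerRatio)) fun ψ => by
      refine (norm_add_le _ _).trans ?_
      rw [norm_mul, add_mul, mul_assoc _ _ ‖ψ‖]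
      refine add_le_add (mul_le_mul_of_nonneg_left ψ.norm_constCoeff_le (norm_nonneg _)) ?_
      rw [← tsum_mul_right]
      refine tsum_of_norm_bounded (hb.mul_right (2 / G.lowerRatio * ‖ψ‖)).hasSum fun p => ?_
      rw [norm_mul, ← ψ.rpow_neg_mul_integral]
      exact mul_le_mul_of_nonneg_left (ψ.norm_rpow_neg_mul_integral_le p) (norm_nonneg _)

theorem hasDualSeries_dualOfCoeff (s : ℝ) (d : ℂ) {b : HaarPair O → ℂ}
    (hb : Summable fun p => ‖b p‖) : HasDualSeries O s (dualOfCoeff s d hb) d b := by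
  refine ⟨hb, fun ψ => ?_⟩
  have h : Summable fun p : HaarPair O =>
      b p * (((μ.real p.cell * p.sqNorm : ℝ) : ℂ) * ψ.coeff p) :=
    (hb.mul_right (2 / G.lowerRatio * ‖ψ‖)).of_norm_bounded fun p => by
      rw [norm_mul, ← ψ.rpow_neg_mul_integral]
      exact mul_le_mul_of_nonneg_left (ψ.norm_rpow_neg_mul_integral_le p) (norm_nonneg _)
  have h1 : dualOfCoeff s d hb ψ = d * ψ.constCoeff +
    ∑' p : HaarPair O, b p * (((μ.real p.cell * p.sqNorm : ℝ) : ℂ) * ψ.coeff p) := rfl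
  rw [h1, ψ.constCoeff_eq, add_sub_cancel_left]
  simpa only [mul_assoc, ψ.rpow_neg_mul_integral] using h.hasSum

namespace BesovNeg

/-- The element of `B^{-s}_{1,1}` with given Haar coefficients. -/
noncomputable def ofCoeff (s : ℝ) (d : ℂ) {b : HaarPair O → ℂ}
    (hb : Summable fun p => ‖b p‖) : BesovNeg O s :=
  ⟨dualOfCoeff s d hb, d, b, hasDualSeries_dualOfCoeff s d hb⟩

theorem coeff_ofCoeff (s : ℝ) (d : ℂ) {b : HaarPair O → ℂ} (hb : Summable fun p => ‖b p‖) :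
    (ofCoeff s d hb).constCoeff = d ∧ (ofCoeff s d hb).coeff = b :=
  eq_coeff (hasDualSeries_dualOfCoeff s d hb)

theorem coeff_sub (φ φ' : BesovNeg O s) : (φ - φ').constCoeff = φ.constCoeff - φ'.constCoeff ∧
    (φ - φ').coeff = φ.coeff - φ'.coeff := by
  have h := coeff_add (φ - φ') φ'
  rw [sub_add_cancel] at h
  exact ⟨eq_sub_of_add_eq h.1.symm, eq_sub_of_add_eq h.2.symm⟩

theorem enorm_def (φ : BesovNeg O s) : ‖φ‖ₑ = ‖φ.constCoeff‖ₑ + ∑' p, ‖φ.coeff p‖ₑ := by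
  rw [← ofReal_norm, norm_def, ENNReal.ofReal_add (norm_nonneg _)
    (tsum_nonneg fun _ => norm_nonneg _), ENNReal.ofReal_tsum_of_nonneg (fun _ => norm_nonneg _)
    φ.hasDualSeries.1]
  simp only [ofReal_norm]

theorem memℓp_coeff (φ : BesovNeg O s) : Memℓp φ.coeff 1 :=
  memℓp_gen (by simpa using φ.hasDualSeries.1)

/-- The Haar coefficients identify `B^{-s}_{1,1}` with a sequence space. -/
noncomputable def toSeq (O : G.ChildOrder) (s : ℝ) :
    BesovNeg O s →ₗᵢ[ℂ] WithLp 1 (ℂ × lp (fun _ : HaarPair O => ℂ) 1) where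
  toFun φ := WithLp.toLp 1 (φ.constCoeff, ⟨φ.coeff, φ.memℓp_coeff⟩)
  map_add' φ φ' := by
    rw [← WithLp.toLp_add, Prod.mk_add_mk]
    congr 2
    · exact (coeff_add φ φ').1
    · exact Subtype.ext (coeff_add φ φ').2
  map_smul' z φ := by
    rw [RingHom.id_apply, ← WithLp.toLp_smul, Prod.smul_mk]
    congr 2
    · exact (coeff_smul z φ).1
    · exact Subtype.ext (coeff_smul z φ).2
  norm_map' φ := by
    have h : ‖(⟨φ.coeff, φ.memℓp_coeff⟩ : lp (fun _ : HaarPair O => ℂ) 1)‖ =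
        ∑' p, ‖φ.coeff p‖ := by
      rw [lp.norm_eq_tsum_rpow (by simp)]
      simp
    rw [LinearMap.coe_mk, AddHom.coe_mk, WithLp.prod_norm_eq_of_L1, norm_def, ← h]
    rfl

/-- Every summable family of coefficients is attained by `ofCoeff`, so the isometry onto ℂ ⊕ ℓ¹
transports completeness. This is what lets absolutely convergent dipole series converge. -/
instance : CompleteSpace (BesovNeg O s) := by
  have hsurj : Function.Surjective (toSeq O s) := by
    intro v
    have hb : Summable fun p => ‖(v.snd : HaarPair O → ℂ) p‖ := by
      simpa using (memℓp_gen_iff (by simp)).1 v.snd.2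
    have h := coeff_ofCoeff s v.fst hb
    exact ⟨ofCoeff s v.fst hb, congrArg (WithLp.toLp 1) (Prod.ext h.1 (Subtype.ext h.2))⟩
  exact (LinearIsometryEquiv.ofSurjective (toSeq O s) hsurj).toIsometryEquiv.completeSpace

/-- The space carries its own norm, so continuity of evaluation at a test function has to come from
the coefficients. -/
theorem norm_toDual_le (φ : BesovNeg O s) (ψ : BesovPos O s) :
    ‖φ.toDual ψ‖ ≤ (1 + 2 / G.lowerRatio) * ‖ψ‖ * ‖φ‖ := by
  have h := φ.hasDualSeries
  have h1 := tsum_of_norm_bounded (h.1.mul_right (2 / G.lowerRatio * ‖ψ‖)).hasSum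
    (f := fun p : HaarPair O => φ.coeff p * ((μ.real p.cell ^ (-s) : ℝ) : ℂ) *
      ∫ ω, ψ.toLp ω * p.wavelet ω ∂μ) fun p => by
    rw [mul_assoc, norm_mul]
    exact mul_le_mul_of_nonneg_left (ψ.norm_rpow_neg_mul_integral_le p) (norm_nonneg _)
  rw [(h.2 ψ).tsum_eq, tsum_mul_right, ← ψ.constCoeff_eq] at h1
  have h2 : ‖φ.constCoeff * ψ.constCoeff‖ ≤ ‖φ.constCoeff‖ * ‖ψ‖ := by
    rw [norm_mul]
    exact mul_le_mul_of_nonneg_left ψ.norm_constCoeff_le (norm_nonneg _)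
  have h3 := norm_sub_norm_le (φ.toDual ψ) (φ.constCoeff * ψ.constCoeff)
  have h4 : 0 ≤ ∑' p, ‖φ.coeff p‖ := tsum_nonneg fun _ => norm_nonneg _
  have h5 := G.lowerRatio_mem.1
  have h6 : 0 ≤ ‖ψ‖ * ∑' p, ‖φ.coeff p‖ := by positivity
  have h7 : 0 ≤ 2 / G.lowerRatio * (‖ψ‖ * ‖φ.constCoeff‖) := by positivity
  rw [norm_def]
  linarith

/-- Evaluation at a test function. -/
noncomputable def eval (ψ : BesovPos O s) : StrongDual ℂ (BesovNeg O s) :=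
  LinearMap.mkContinuous
    { toFun := fun φ => φ.toDual ψ
      map_add' := fun _ _ => rfl
      map_smul' := fun _ _ => rfl }
    ((1 + 2 / G.lowerRatio) * ‖ψ‖) fun φ => φ.norm_toDual_le ψ

theorem eval_apply (ψ : BesovPos O s) (φ : BesovNeg O s) : eval ψ φ = φ.toDual ψ := rfl

theorem eval_one (φ : BesovNeg O s) : eval (BesovPos.one O s) φ = φ.constCoeff :=
  φ.hasDualSeries.const_eq.symm

theorem coeff_mul_eq (φ : BesovNeg O s) (p : HaarPair O) :
    φ.coeff p * ((μ.real p.cell ^ (-s) : ℝ) : ℂ) * (p.sqNorm : ℂ) =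
      eval (BesovPos.ofPair s p) φ := by
  rw [← p.integral_wavelet_mul_self]
  exact φ.hasDualSeries.coeff_eq p

/-- An element of `B^{-s}_{1,1}` without Haar coefficients vanishes. -/
theorem eq_zero_of_eval {φ : BesovNeg O s} (h0 : eval (BesovPos.one O s) φ = 0)
    (h : ∀ p, eval (BesovPos.ofPair s p) φ = 0) : φ = 0 := by
  have h1 : ∀ p, φ.coeff p = 0 := by
    intro p
    have h1 := φ.coeff_mul_eq p
    rw [h p] at h1
    have h2 : (p.sqNorm : ℂ) ≠ 0 := by exact_mod_cast p.sqNorm_pos.ne'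
    exact (mul_eq_zero.1 ((mul_eq_zero.1 h1).resolve_right h2)).resolve_right (p.rpow_ne_zero _)
  rw [eval_one] at h0
  rw [← norm_eq_zero, norm_def, h0]
  simp [h1]

end BesovNeg

end

/-! ### Dirac masses and their Haar coefficients. -/

section

variable {Ω : Type*} [MeasurableSpace Ω] {μ : Measure Ω} {G : GoodGrid μ}

theorem GoodGrid.Point.seq_eq_of_le {x y : G.Point} [IsProbabilityMeasure μ] {j n : ℕ}
    (hjn : j ≤ n) (h : x.seq n = y.seq n) : x.seq j = y.seq j :=
  G.eq_of_le_of_le (x.seq_mem j) (y.seq_mem j) (G.real_pos _ _ (x.seq_mem n)) (x.seq_le hjn)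
    (h ▸ y.seq_le hjn)

variable [IsProbabilityMeasure μ] {O : G.ChildOrder} {s : ℝ}

theorem GoodGrid.Point.seq_level {x : G.Point} {p : HaarPair O}
    (h : x.seq (p.level + 1) ≤ᵐ[μ] p.cell) : x.seq p.level = p.cell :=
  G.eq_of_le_of_le (x.seq_mem _) p.cell_mem (G.real_pos _ _ (x.seq_mem (p.level + 1)))
    (x.seq_succ _) h

/-- The Haar coefficients of the Dirac mass at a point. -/
noncomputable def diracCoeff (s : ℝ) (x : G.Point) (p : HaarPair O) : ℂ :=
  ((μ.real p.cell ^ s : ℝ) : ℂ) / (p.sqNorm : ℂ) *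
    ((∫ ω in x.seq (p.level + 1), p.wavelet ω ∂μ) / (μ.real (x.seq (p.level + 1)) : ℂ))

-- The coefficient is φ_p(x) |Q|^s / ‖φ_p‖², where φ_p(x) is the mean over the cell of x at the
-- level of the children. On a child |φ_p| is at most ‖φ_p‖², so only |Q|^s is left; off the branch
-- of x the wavelet contributes nothing.
open scoped Classical in
theorem enorm_diracCoeff_le (s : ℝ) (x : G.Point) (p : HaarPair O) :
    ‖diracCoeff s x p‖ₑ ≤
      if p.cell = x.seq p.level then ENNReal.ofReal (μ.real p.cell ^ s) else 0 := by
  have h1 := p.norm_setIntegral_wavelet_le (Nat.lt_succ_self _) (x.seq_mem (p.level + 1))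
  split_ifs with h
  · rw [← ofReal_norm]
    refine ENNReal.ofReal_le_ofReal ?_
    have h2 := G.real_pos _ _ (x.seq_mem (p.level + 1))
    have h3 := p.sqNorm_pos
    have h4 : 0 ≤ μ.real p.cell ^ s := Real.rpow_nonneg measureReal_nonneg _
    rw [diracCoeff, norm_mul, norm_div, norm_div, Complex.norm_of_nonneg h4,
      Complex.norm_of_nonneg h3.le, Complex.norm_of_nonneg h2.le, div_mul_div_comm,
      div_le_iff₀ (mul_pos h3 h2)]
    exact mul_le_mul_of_nonneg_left h1.1 h4
  · rw [diracCoeff, h1.2 fun h' => h (GoodGrid.Point.seq_level h').symm]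
    simp

theorem diracCoeff_congr {x y : G.Point} {p : HaarPair O} {n : ℕ} (hp : p.level < n)
    (h : x.seq n = y.seq n) : diracCoeff s x p = diracCoeff s y p := by
  rw [diracCoeff, diracCoeff, GoodGrid.Point.seq_eq_of_le hp h]

theorem summable_norm_of_tsum_enorm_ne_top {ι E : Type*} [NormedAddCommGroup E]
    {b : ι → E}
    (h : ∑' i, ‖b i‖ₑ ≠ ∞) : Summable fun i => ‖b i‖ := by
  have := ENNReal.summable_toReal h
  simpa using this

theorem summable_diracCoeff (hs : 0 < s) (x : G.Point) :
    Summable fun p : HaarPair O => ‖diracCoeff s x p‖ := by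
  classical
  refine summable_norm_of_tsum_enorm_ne_top (ne_top_of_le_ne_top
    (ENNReal.mul_ne_top (haarConst_ne_top G hs) ENNReal.ofReal_ne_top)
    ((ENNReal.tsum_le_tsum fun p => ?_).trans (tsum_haarPair_seq_le O hs x 0)))
  simpa using enorm_diracCoeff_le s x p

theorem summable_diracCoeff_truncated (hs : 0 < s) (x : G.Point) (j : ℕ) :
    Summable fun p : HaarPair O => ‖if p.level < j then diracCoeff s x p else 0‖ := by
  refine (summable_diracCoeff hs x).of_nonneg_of_le (fun _ => norm_nonneg _) fun p => ?_
  split_ifs <;> simp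

/-- The Dirac mass at a point. -/
noncomputable def diracMass (O : G.ChildOrder) (hs : 0 < s) (x : G.Point) : BesovNeg O s :=
  BesovNeg.ofCoeff s 1 (summable_diracCoeff hs x)

/-- The normalized indicator function of a cell. -/
noncomputable def cellMean (O : G.ChildOrder) (hs : 0 < s) (x : G.Point) (j : ℕ) :
    BesovNeg O s :=
  BesovNeg.ofCoeff s 1 (summable_diracCoeff_truncated hs x j)

/-- The mean of φ_p over Q_j equals φ_p(x) when the level of p is below j, and vanishes otherwise.
Averaging over Q_j therefore truncates the Haar series of the Dirac mass. -/
theorem cellMean_toDual (hs : 0 < s) (x : G.Point) (j : ℕ) (ψ : BesovPos O s) :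
    (cellMean O hs x j).toDual ψ = (∫ ω in x.seq j, ψ.toLp ω ∂μ) / (μ.real (x.seq j) : ℂ) := by
  classical
  have h1 := (hasDualSeries_dualOfCoeff s 1 (summable_diracCoeff_truncated (O := O) hs x j)).2 ψ
  have hj : (μ.real (x.seq j) : ℂ) ≠ 0 := by
    exact_mod_cast (G.real_pos _ _ (x.seq_mem j)).ne'
  have h2 := (ψ.hasSum_setIntegral (G.measurable_cell j _ (x.seq_mem j))).div_const
    (μ.real (x.seq j) : ℂ)
  have h3 : ∀ p : HaarPair O, (if p.level < j then diracCoeff s x p else 0) *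
      ((μ.real p.cell ^ (-s) : ℝ) : ℂ) * ∫ ω, ψ.toLp ω * p.wavelet ω ∂μ =
      ((μ.real p.cell ^ (1 + s) : ℝ) : ℂ) * ψ.coeff p *
      (∫ ω in x.seq j, p.wavelet ω ∂μ) / (μ.real (x.seq j) : ℂ) := by
    intro p
    split_ifs with h
    · have hp : (μ.real (x.seq (p.level + 1)) : ℂ) ≠ 0 := by
        exact_mod_cast (G.real_pos _ _ (x.seq_mem (p.level + 1))).ne'
      have hq : (p.sqNorm : ℂ) ≠ 0 := by exact_mod_cast p.sqNorm_pos.ne'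
      rw [mul_assoc, ψ.rpow_neg_mul_integral, diracCoeff, p.rpow_one_add,
        p.setIntegral_wavelet_of_le (x.seq_mem (p.level + 1)) EventuallyLE.rfl,
        p.setIntegral_wavelet_of_le (x.seq_mem (p.level + 1)) (x.seq_le h)]
      push_cast
      field_simp
    · rw [p.setIntegral_wavelet_eq_zero (not_lt.1 h) (x.seq_mem j)]
      simp
  simp only [h3] at h1
  have h4 := h1.unique h2
  rw [sub_div, mul_div_cancel_right₀ _ hj, one_mul] at h4
  exact sub_left_inj.1 h4

/-- The difference is the tail of the Haar series along the branch, from level j on. -/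
theorem edist_cellMean_le (hs : 0 < s) (x : G.Point) (j : ℕ) :
    edist (cellMean O hs x j) (diracMass O hs x) ≤
      haarConst G s * ENNReal.ofReal (μ.real (x.seq j) ^ s) := by
  classical
  rw [edist_eq_enorm_sub, BesovNeg.enorm_def, (BesovNeg.coeff_sub _ _).1,
    (BesovNeg.coeff_sub _ _).2, cellMean, diracMass, (BesovNeg.coeff_ofCoeff _ _ _).1,
    (BesovNeg.coeff_ofCoeff _ _ _).1, (BesovNeg.coeff_ofCoeff _ _ _).2,
    (BesovNeg.coeff_ofCoeff _ _ _).2, sub_self, enorm_zero, zero_add]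
  refine (ENNReal.tsum_le_tsum fun p => ?_).trans (tsum_haarPair_seq_le O hs x j)
  rw [Pi.sub_apply]
  by_cases h : p.level < j
  · simp [h]
  · have := enorm_diracCoeff_le s x p
    simpa [h, not_lt.1 h] using this

theorem isDiracMass_diracMass (hs : 0 < s) (x : G.Point) :
    IsDiracMass O s x (diracMass O hs x) := by
  refine ⟨cellMean O hs x, cellMean_toDual hs x, ?_⟩
  rw [tendsto_iff_edist_tendsto_0]
  have h1 : Tendsto (fun j => haarConst G s * (ENNReal.ofReal (G.upperRatio ^ s) ^ j *
      ENNReal.ofReal (μ.real (x.seq 0) ^ s))) atTop (𝓝 0) := by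
    have h := Real.rpow_lt_one G.upperRatio_mem.1.le G.upperRatio_mem.2 hs
    have h2 := ENNReal.Tendsto.const_mul (ENNReal.Tendsto.mul_const
      (ENNReal.tendsto_pow_atTop_nhds_zero_of_lt_one (ENNReal.ofReal_lt_one.2 h))
      (Or.inr (ENNReal.ofReal_ne_top (r := μ.real (x.seq 0) ^ s)))) (Or.inr (haarConst_ne_top G hs))
    rwa [zero_mul, mul_zero] at h2
  refine tendsto_of_tendsto_of_tendsto_of_le_of_le tendsto_const_nhds h1 (fun _ => zero_le)
    fun j => (edist_cellMean_le hs x j).trans ?_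
  refine mul_le_mul_right ?_ _
  have h2 := G.rpow_le_pow_mul hs (x.seq_mem 0) (i := j) (by rw [zero_add]; exact x.seq_mem j)
    (x.seq_le (Nat.zero_le j))
  exact h2

/-- Dirac masses at points in the same small cell are close. -/
theorem enorm_diracMass_sub_le (hs : 0 < s) {x y : G.Point} {n : ℕ} (h : x.seq n = y.seq n) :
    ‖diracMass O hs x - diracMass O hs y‖ₑ ≤
      2 * (haarConst G s * ENNReal.ofReal (μ.real (x.seq n) ^ s)) := by
  classical
  rw [BesovNeg.enorm_def, (BesovNeg.coeff_sub _ _).1,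
    (BesovNeg.coeff_sub _ _).2, diracMass, diracMass, (BesovNeg.coeff_ofCoeff _ _ _).1,
    (BesovNeg.coeff_ofCoeff _ _ _).1, (BesovNeg.coeff_ofCoeff _ _ _).2,
    (BesovNeg.coeff_ofCoeff _ _ _).2, sub_self, enorm_zero, zero_add, two_mul]
  have hx := tsum_haarPair_seq_le O hs x n
  have hy := tsum_haarPair_seq_le O hs y n
  rw [← h] at hy
  refine le_trans ?_ (add_le_add hx hy)
  rw [← ENNReal.tsum_add]
  refine ENNReal.tsum_le_tsum fun p => ?_
  rw [Pi.sub_apply]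
  by_cases hp : p.level < n
  · rw [diracCoeff_congr hp h, sub_self, enorm_zero]
    exact zero_le
  · simp only [not_lt.1 hp, true_and]
    exact enorm_sub_le.trans
      (add_le_add (enorm_diracCoeff_le s x p) (enorm_diracCoeff_le s y p))

theorem tendsto_setIntegral_diracMass (hs : 0 < s) (x : G.Point) (ψ : BesovPos O s) :
    Tendsto (fun j => (∫ ω in x.seq j, ψ.toLp ω ∂μ) / (μ.real (x.seq j) : ℂ)) atTop
      (𝓝 (BesovNeg.eval ψ (diracMass O hs x))) := by
  obtain ⟨u, hu, hlim⟩ := isDiracMass_diracMass (O := O) hs x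
  simp only [← hu]
  exact ((BesovNeg.eval ψ).continuous.tendsto _).comp hlim

end

/-! ### Indicators of blocks as test functions. -/

section

variable {Ω : Type*} [MeasurableSpace Ω] {μ : Measure Ω} {G : GoodGrid μ}

theorem blockSum_append {Ω : Type*} (S T : List (Set Ω)) (ω : Ω) :
    blockSum (S ++ T) ω = blockSum S ω + blockSum T ω := by
  simp [blockSum]

theorem GoodGrid.ChildOrder.blockSum_children (O : G.ChildOrder) {k : ℕ} {Q : Set Ω}
    (hQ : Q ∈ G.cells k) : blockSum (O.children k Q) =ᵐ[μ] blockSum [Q] := by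
  refine (G.ae_blockSum (O.nodup k Q hQ) fun R hR =>
    ((O.mem_children k Q hQ R).1 hR).1).trans ?_
  refine (indicator_ae_eq_of_ae_eq_set (O.ae_blockSet_children hQ)).trans ?_
  exact Eventually.of_forall fun ω => by simp [blockSum]

variable [IsProbabilityMeasure μ] {O : G.ChildOrder} {s : ℝ}

namespace BesovPos

/-- The function `ψ` is the sum of the indicator functions of the cells of the block `S`. -/
def IsBlock (ψ : BesovPos O s) (S : List (Set Ω)) : Prop := ψ.toLp =ᵐ[μ] blockSum S

theorem IsBlock.congr {ψ : BesovPos O s} {S T : List (Set Ω)} (h : ψ.IsBlock S)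
    (hST : blockSum S =ᵐ[μ] blockSum T) : ψ.IsBlock T :=
  h.trans hST

theorem ext_ae {ψ ψ' : BesovPos O s} (h : ψ.toLp =ᵐ[μ] ψ'.toLp) : ψ = ψ' :=
  Subtype.ext (Lp.ext h)

theorem toLp_add_ae (ψ ψ' : BesovPos O s) :
    (ψ + ψ').toLp =ᵐ[μ] fun ω => ψ.toLp ω + ψ'.toLp ω :=
  Lp.coeFn_add ψ.toLp ψ'.toLp

theorem toLp_smul_ae (z : ℂ) (ψ : BesovPos O s) :
    (z • ψ).toLp =ᵐ[μ] fun ω => z * ψ.toLp ω :=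
  Lp.coeFn_smul z ψ.toLp

theorem toLp_ofPair_ae (p : HaarPair O) : (ofPair s p).toLp =ᵐ[μ] p.wavelet :=
  (p.memLp_wavelet ∞).coeFn_toLp

theorem isBlock_one : (one O s).IsBlock [univ] := by
  filter_upwards [Lp.coeFn_const (p := ∞) (μ := μ) (1 : ℂ)] with ω h
  refine h.trans ?_
  simp [blockSum]

theorem IsBlock.eq {ψ ψ' : BesovPos O s} {S : List (Set Ω)} (h : ψ.IsBlock S)
    (h' : ψ'.IsBlock S) : ψ = ψ' :=
  ext_ae (h.trans h'.symm)

theorem IsBlock.add {ψ ψ' : BesovPos O s} {S T : List (Set Ω)} (h : ψ.IsBlock S)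
    (h' : ψ'.IsBlock T) : (ψ + ψ').IsBlock (S ++ T) := by
  filter_upwards [toLp_add_ae ψ ψ', h, h'] with ω h1 h2 h3
  rw [h1, h2, h3, blockSum_append]

theorem IsBlock.ofPair_eq {ψ ψ' : BesovPos O s} {p : HaarPair O} (h : ψ.IsBlock p.fst)
    (h' : ψ'.IsBlock p.snd) : ofPair s p =
      (blockMass μ p.fst : ℂ)⁻¹ • ψ + (-(blockMass μ p.snd : ℂ)⁻¹) • ψ' := by
  refine ext_ae ?_
  filter_upwards [toLp_ofPair_ae (s := s) p, toLp_add_ae ((blockMass μ p.fst : ℂ)⁻¹ • ψ)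
    ((-(blockMass μ p.snd : ℂ)⁻¹) • ψ'), toLp_smul_ae (blockMass μ p.fst : ℂ)⁻¹ ψ,
    toLp_smul_ae (-(blockMass μ p.snd : ℂ)⁻¹) ψ', h, h'] with ω h1 h2 h3 h4 h5 h6
  rw [h1, h2, h3, h4, h5, h6, HaarPair.wavelet]
  ring

/-- With masses m₁ and m₂, the indicator of a half is a combination of the indicator of the block
and of the wavelet: 1_{S₁} = (m₁ 1_{S₁ ∪ S₂} + m₁ m₂ φ_p) / (m₁ + m₂), and 1_{S₂} = (m₂ 1_{S₁ ∪ S₂}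
- m₁ m₂ φ_p) / (m₁ + m₂). -/
theorem exists_isBlock_halves {ψ : BesovPos O s} {p : HaarPair O}
    (h : ψ.IsBlock (p.fst ++ p.snd)) :
    (∃ ψ₁ : BesovPos O s, ψ₁.IsBlock p.fst) ∧ ∃ ψ₂ : BesovPos O s, ψ₂.IsBlock p.snd := by
  have hm1 := p.blockMass_fst_pos
  have hm2 := p.blockMass_snd_pos
  have h1 : (blockMass μ p.fst : ℂ) ≠ 0 := by exact_mod_cast hm1.ne'
  have h2 : (blockMass μ p.snd : ℂ) ≠ 0 := by exact_mod_cast hm2.ne'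
  have h3 : (blockMass μ p.fst : ℂ) + (blockMass μ p.snd : ℂ) ≠ 0 := by
    exact_mod_cast (add_pos hm1 hm2).ne'
  have key : ∀ a b : ℂ, (a • ψ + b • ofPair s p).toLp =ᵐ[μ] fun ω =>
      a * (blockSum p.fst ω + blockSum p.snd ω) + b * p.wavelet ω := by
    intro a b
    filter_upwards [toLp_add_ae (a • ψ) (b • ofPair s p), toLp_smul_ae a ψ,
      toLp_smul_ae b (ofPair s p), toLp_ofPair_ae (s := s) p, h] with ω e1 e2 e3 e4 e5
    rw [e1, e2, e3, e4, e5, blockSum_append]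
  set m₁ := (blockMass μ p.fst : ℂ) with hm₁
  set m₂ := (blockMass μ p.snd : ℂ) with hm₂
  refine ⟨⟨_, (key (m₁ / (m₁ + m₂)) (m₁ * m₂ / (m₁ + m₂))).trans
    (Eventually.of_forall fun ω => ?_)⟩, ⟨_, (key (m₂ / (m₁ + m₂)) (-(m₁ * m₂) / (m₁ + m₂))).trans
    (Eventually.of_forall fun ω => ?_)⟩⟩
  · simp only [HaarPair.wavelet, ← hm₁, ← hm₂]
    field_simp
    ring
  · simp only [HaarPair.wavelet, ← hm₁, ← hm₂]
    field_simp
    ring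

theorem exists_isBlock (s : ℝ) (p : HaarPair O) :
    (∃ ψ : BesovPos O s, ψ.IsBlock p.fst) ∧ ∃ ψ : BesovPos O s, ψ.IsBlock p.snd :=
  (O.block_induction (C := fun _ S => ∃ ψ : BesovPos O s, ψ.IsBlock S) ⟨_, isBlock_one⟩
    (fun _ _ hQ ⟨ψ, hψ⟩ => ⟨ψ, hψ.congr (O.blockSum_children hQ).symm⟩)
    (fun _ ⟨_, hψ⟩ => exists_isBlock_halves hψ) p).2

end BesovPos

namespace BesovNeg

/-- A functional that vanishes on the whole space and on one half of every block vanishes. -/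
theorem eq_zero_of_eval_half {φ : BesovNeg O s} (h0 : eval (BesovPos.one O s) φ = 0)
    (h : ∀ p : HaarPair O, ∃ ψ : BesovPos O s, (ψ.IsBlock p.fst ∨ ψ.IsBlock p.snd) ∧
      eval ψ φ = 0) : φ = 0 := by
  refine eq_zero_of_eval h0 fun p => ?_
  have key := (O.block_induction (C := fun _ S => ∀ ψ : BesovPos O s, ψ.IsBlock S →
    eval ψ φ = 0) (fun ψ hψ => hψ.eq BesovPos.isBlock_one ▸ h0)
    (fun k Q hQ hC ψ hψ => hC ψ (hψ.congr (O.blockSum_children hQ))) (fun q hC => ?_) p).2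
  · obtain ⟨⟨ψ₁, h₁⟩, ⟨ψ₂, h₂⟩⟩ := BesovPos.exists_isBlock s p
    have e1 := key.1 ψ₁ h₁
    have e2 := key.2 ψ₂ h₂
    rw [eval_apply] at e1 e2 ⊢
    rw [h₁.ofPair_eq h₂, map_add, map_smul, map_smul, e1, e2]
    simp
  · obtain ⟨⟨ψ₁, h₁⟩, ⟨ψ₂, h₂⟩⟩ := BesovPos.exists_isBlock s q
    -- The values at the two halves add up to the value at the block, which is zero; as one of them
    -- vanishes, so does the other.
    have e := hC _ (h₁.add h₂)
    rw [eval_apply, map_add, ← eval_apply, ← eval_apply] at e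
    obtain ⟨ψ, hψ | hψ, hz⟩ := h q
    · rw [hψ.eq h₁] at hz
      rw [hz, zero_add] at e
      exact ⟨fun ψ' h' => h'.eq h₁ ▸ hz, fun ψ' h' => h'.eq h₂ ▸ e⟩
    · rw [hψ.eq h₂] at hz
      rw [hz, add_zero] at e
      exact ⟨fun ψ' h' => h'.eq h₁ ▸ e, fun ψ' h' => h'.eq h₂ ▸ hz⟩

end BesovNeg

-- From j = n on, Q_j lies in a single cell of level n, so the averages of the indicator over Q_j
-- are already constant.
open scoped Classical in
theorem eval_diracMass (hs : 0 < s) (x : G.Point) {ψ : BesovPos O s} {S : List (Set Ω)} {n : ℕ}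
    (hψ : ψ.IsBlock S) (hnd : S.Nodup) (hS : ∀ R ∈ S, R ∈ G.cells n) :
    BesovNeg.eval ψ (diracMass O hs x) = if x.seq n ∈ S then 1 else 0 := by
  refine tendsto_nhds_unique (tendsto_setIntegral_diracMass hs x ψ)
    (tendsto_const_nhds.congr' ?_)
  filter_upwards [eventually_ge_atTop n] with j hj
  have hpos : (μ.real (x.seq j) : ℂ) ≠ 0 := by
    exact_mod_cast (G.real_pos _ _ (x.seq_mem j)).ne'
  rw [integral_congr_ae (ae_restrict_of_ae hψ),
    setIntegral_blockSum fun R hR => G.measurable_cell n R (hS R hR), eq_div_iff hpos,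
    ← List.sum_toFinset _ hnd, Finset.sum_congr rfl fun R hR =>
      G.real_inter (hS R (List.mem_toFinset.1 hR)) (x.seq_mem n) (x.seq_le hj),
    Finset.sum_ite_eq']
  by_cases h : x.seq n ∈ S <;> simp [h]

/-! ### Summability of the values at blocks. -/

/-- The pairing of a block below `p.cell` with a wavelet. -/
theorem norm_integral_blockSum_mul_wavelet_le (p q : HaarPair O) {S : List (Set Ω)}
    (hnd : S.Nodup) (hS : ∀ R ∈ S, R ∈ p.fst ++ p.snd) :
    ‖∫ ω, blockSum S ω * q.wavelet ω ∂μ‖ ≤ q.sqNorm * μ.real p.cell ∧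
      (¬ (q.level ≤ p.level ∧ p.cell ≤ᵐ[μ] q.cell) →
        ∫ ω, blockSum S ω * q.wavelet ω ∂μ = 0) := by
  classical
  have hm : ∀ R ∈ S, R ∈ G.cells (p.level + 1) ∧ R ≤ᵐ[μ] p.cell := fun R hR =>
    p.mem_cells (hS R hR)
  have h1 : ∫ ω, blockSum S ω * q.wavelet ω ∂μ = ∑ R ∈ S.toFinset, ∫ ω in R, q.wavelet ω ∂μ := by
    rw [List.sum_toFinset _ hnd, ← (integral_mul_blockSum q.integrable_wavelet fun R hR =>
      G.measurable_cell _ R (hm R hR).1).2]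
    simp only [mul_comm]
  have hzero : ¬ (q.level ≤ p.level ∧ p.cell ≤ᵐ[μ] q.cell) →
      ∫ ω, blockSum S ω * q.wavelet ω ∂μ = 0 := by
    intro h
    rw [h1]
    refine Finset.sum_eq_zero fun R hR => ?_
    obtain ⟨hR1, hR2⟩ := hm R (List.mem_toFinset.1 hR)
    by_cases hl : q.level ≤ p.level
    · refine (q.norm_setIntegral_wavelet_le (Nat.lt_succ_of_le hl) hR1).2 fun h' => h ⟨hl, ?_⟩
      -- If the child R of `p.cell` lies in the coarser cell `q.cell`, then so does all of `p.cell`.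
      exact G.le_of_le_of_le hl q.cell_mem p.cell_mem (G.real_pos _ _ hR1) h' hR2
    · exact q.setIntegral_wavelet_eq_zero (Nat.lt_of_not_le hl) hR1
  refine ⟨?_, hzero⟩
  by_cases h : q.level ≤ p.level ∧ p.cell ≤ᵐ[μ] q.cell
  · rw [h1]
    refine (norm_sum_le_of_le _ fun R hR => (q.norm_setIntegral_wavelet_le
      (Nat.lt_succ_of_le h.1) (hm R (List.mem_toFinset.1 hR)).1).1).trans ?_
    rw [← Finset.mul_sum, List.sum_toFinset _ hnd]
    exact mul_le_mul_of_nonneg_left (G.blockMass_le hnd hm) q.sqNorm_pos.le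
  · rw [hzero h, norm_zero]
    exact mul_nonneg q.sqNorm_pos.le measureReal_nonneg

-- In the Haar series of φ only the wavelets of cells containing `p.cell` see the block. Each
-- integral is at most ‖φ_q‖² |Q_p|, the bound of the wavelet times the mass available to the block.
open scoped Classical in
theorem enorm_eval_block_le (φ : BesovNeg O s) {p : HaarPair O} {ψ : BesovPos O s}
    {S : List (Set Ω)} (hψ : ψ.IsBlock S) (hnd : S.Nodup) (hS : ∀ R ∈ S, R ∈ p.fst ++ p.snd) :
    ‖BesovNeg.eval ψ φ‖ₑ ≤ ‖φ.constCoeff‖ₑ * μ p.cell +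
      ∑' q : HaarPair O, ‖φ.coeff q‖ₑ * ENNReal.ofReal (μ.real q.cell ^ (-s) * q.sqNorm) *
        (if q.level ≤ p.level ∧ p.cell ≤ᵐ[μ] q.cell then μ p.cell else 0) := by
  have hm : ∀ R ∈ S, R ∈ G.cells (p.level + 1) ∧ R ≤ᵐ[μ] p.cell := fun R hR =>
    p.mem_cells (hS R hR)
  have h1 := (φ.hasDualSeries.2 ψ).tsum_eq
  rw [BesovNeg.eval_apply, ← sub_add_cancel (φ.toDual ψ) (φ.constCoeff * ∫ ω, ψ.toLp ω ∂μ), ← h1,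
    add_comm]
  refine (enorm_add_le _ _).trans (add_le_add ?_ ?_)
  · rw [enorm_mul]
    refine mul_le_mul_right ?_ _
    have h2 : ∫ ω, ψ.toLp ω ∂μ = ((blockMass μ S : ℝ) : ℂ) := by
      rw [integral_congr_ae hψ]
      have := setIntegral_blockSum (μ := μ) (fun R hR => G.measurable_cell _ R (hm R hR).1) univ
      simpa [blockMass] using this
    have h3 : 0 ≤ blockMass μ S := List.sum_nonneg (by
      intro x hx
      obtain ⟨R', -, rfl⟩ := List.mem_map.1 hx
      exact measureReal_nonneg)
    rw [h2, ← ofReal_norm, Complex.norm_of_nonneg h3, ← ofReal_measureReal]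
    exact ENNReal.ofReal_le_ofReal (G.blockMass_le hnd hm)
  · refine enorm_tsum_le_tsum_enorm.trans (ENNReal.tsum_le_tsum fun q => ?_)
    have h2 : ∫ ω, ψ.toLp ω * q.wavelet ω ∂μ = ∫ ω, blockSum S ω * q.wavelet ω ∂μ :=
      integral_congr_ae (hψ.mul EventuallyEq.rfl)
    have h3 := norm_integral_blockSum_mul_wavelet_le p q hnd hS
    rw [h2, mul_assoc, mul_assoc, enorm_mul]
    refine mul_le_mul_right ?_ _
    split_ifs with h
    · have h4 : 0 ≤ μ.real q.cell ^ (-s) := Real.rpow_nonneg measureReal_nonneg _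
      rw [← ofReal_norm, norm_mul, Complex.norm_of_nonneg h4, ← ofReal_measureReal,
        ← ENNReal.ofReal_mul (mul_nonneg h4 q.sqNorm_pos.le), mul_assoc]
      exact ENNReal.ofReal_le_ofReal (mul_le_mul_of_nonneg_left h3.1 h4)
    · rw [h3.2 h]
      simp

/-- The values of a functional at blocks, weighted with the norms of the dipoles, are summable. -/
theorem tsum_enorm_eval_block_ne_top (hs : 0 < s) (φ : BesovNeg O s)
    {ψ : HaarPair O → BesovPos O s}
    (hψ : ∀ p, (ψ p).IsBlock p.fst ∨ (ψ p).IsBlock p.snd) :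
    ∑' p : HaarPair O, ENNReal.ofReal (μ.real p.cell ^ s) * ‖BesovNeg.eval (ψ p) φ‖ₑ ≠ ∞ := by
  classical
  have hbound : ∀ p, ‖BesovNeg.eval (ψ p) φ‖ₑ ≤ ‖φ.constCoeff‖ₑ * μ p.cell +
      ∑' q : HaarPair O, ‖φ.coeff q‖ₑ * ENNReal.ofReal (μ.real q.cell ^ (-s) * q.sqNorm) *
        (if q.level ≤ p.level ∧ p.cell ≤ᵐ[μ] q.cell then μ p.cell else 0) := by
    intro p
    have hnd := List.nodup_append.1 p.nodup_append
    rcases hψ p with h | h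
    · exact enorm_eval_block_le φ h hnd.1 fun R hR => List.mem_append_left _ hR
    · exact enorm_eval_block_le φ h hnd.2.1 fun R hR => List.mem_append_right _ hR
  have h1 : ∑' p : HaarPair O, ENNReal.ofReal (μ.real p.cell ^ s) * μ p.cell ≤
      haarConst G s := by
    have h := tsum_haarPair_below_le O hs (n := 0) (P := univ) (by simp [G.cells_zero])
    have h' : ∀ A : Set Ω, A ≤ᵐ[μ] (univ : Set Ω) := fun A => ae_of_all _ fun _ _ => trivial
    simpa [h'] using h
  -- For a single q the sum over p is at most C |Q_q|^(1+s). The factor |Q_q|^(-s) cancels the power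
  -- s, and |Q_q| ‖φ_q‖² ≤ 2/λ_*.
  have h2 : ∀ q : HaarPair O, ENNReal.ofReal (μ.real q.cell ^ (-s) * q.sqNorm) *
      ∑' p : HaarPair O, (if q.level ≤ p.level ∧ p.cell ≤ᵐ[μ] q.cell
        then ENNReal.ofReal (μ.real p.cell ^ s) * μ p.cell else 0) ≤
      haarConst G s * ENNReal.ofReal (2 / G.lowerRatio) := by
    intro q
    refine (mul_le_mul_right (tsum_haarPair_below_le O hs q.cell_mem) _).trans ?_
    have h4 : 0 ≤ μ.real q.cell ^ (-s) := Real.rpow_nonneg measureReal_nonneg _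
    have h5 : 0 ≤ μ.real q.cell ^ s := Real.rpow_nonneg measureReal_nonneg _
    rw [mul_left_comm, ← ofReal_measureReal, ← ENNReal.ofReal_mul h5,
      ← ENNReal.ofReal_mul (mul_nonneg h4 q.sqNorm_pos.le)]
    refine mul_le_mul_right (ENNReal.ofReal_le_ofReal ?_) _
    have h6 : μ.real q.cell ^ (-s) * μ.real q.cell ^ s = 1 := by
      rw [← Real.rpow_add (G.real_pos _ _ q.cell_mem), neg_add_cancel, Real.rpow_zero]
    have h7 := q.real_mul_sqNorm_le
    linear_combination h7 + q.sqNorm * μ.real q.cell * h6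
  refine ne_top_of_le_ne_top (b := ‖φ.constCoeff‖ₑ * haarConst G s +
    (∑' q, ‖φ.coeff q‖ₑ) * (haarConst G s * ENNReal.ofReal (2 / G.lowerRatio))) ?_
    ((ENNReal.tsum_le_tsum fun p => mul_le_mul_right (hbound p) _).trans ?_)
  · have h3 : ∑' q, ‖φ.coeff q‖ₑ ≠ ∞ := by
      refine ne_top_of_le_ne_top (enorm_ne_top (x := φ)) ?_
      rw [BesovNeg.enorm_def]
      exact le_add_self
    have h4 := haarConst_ne_top G hs
    finiteness
  · simp only [mul_add]
    rw [ENNReal.tsum_add]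
    refine add_le_add ?_ ?_
    · simp only [mul_left_comm _ ‖φ.constCoeff‖ₑ]
      rw [ENNReal.tsum_mul_left]
      exact mul_le_mul_right h1 _
    · simp only [← ENNReal.tsum_mul_left]
      -- With q outside, the inner sum runs over the pairs below q, where `h2` is uniform.
      rw [ENNReal.tsum_comm, ← ENNReal.tsum_mul_right]
      refine ENNReal.tsum_le_tsum fun q => ?_
      refine le_trans (le_of_eq ?_) (mul_le_mul_right (h2 q) _)
      rw [← ENNReal.tsum_mul_left, ← ENNReal.tsum_mul_left]
      refine tsum_congr fun p => ?_
      split_ifs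
      · ring
      · simp

end

/-! ### The new halves, biorthogonality, and the dipole basis. -/

section

theorem HasSum.option {ι E : Type*} [AddCommMonoid E] [TopologicalSpace E] [ContinuousAdd E]
    {f : Option ι → E} {v : E} (h : HasSum (fun i => f (some i)) v) : HasSum f (f none + v) := by
  classical
  have h1 : HasSum (Function.update f none 0) v := by
    refine ((Option.some_injective ι).hasSum_iff fun i hi => ?_).1 ?_
    · cases i with
      | none => simp
      | some i => exact absurd ⟨i, rfl⟩ hi
    · convert h using 1
      funext i
      simp
  convert (hasSum_pi_single none (f none)).add h1 using 1
  ext i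
  cases i <;> simp

variable {Ω : Type*} [MeasurableSpace Ω] {μ : Measure Ω} {G : GoodGrid μ} {O : G.ChildOrder}

theorem blockSet_mono {Ω : Type*} {S T : List (Set Ω)} (h : S ⊆ T) : blockSet S ⊆ blockSet T :=
  biUnion_subset_biUnion_left h

theorem HaarPair.blockSet_le_cell (p : HaarPair O) : blockSet (p.fst ++ p.snd) ≤ᵐ[μ] p.cell :=
  (blockSet_mono p.isHaarPair.tree.2.2.subset).eventuallyLE.trans
    (O.ae_blockSet_children p.cell_mem).le

/-- Every block that is halved is a member of the family. -/
theorem HaarPair.exists_family (p : HaarPair O) :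
    ∃ A : O.family, A.1 =ᵐ[μ] blockSet (p.fst ++ p.snd) := by
  refine (O.block_induction (C := fun _ S => ∃ A : O.family, A.1 =ᵐ[μ] blockSet S)
    ⟨O.whole, ?_⟩ (fun k Q hQ hA => ?_) (fun q _ => ⟨⟨O.firstHalf q, EventuallyEq.rfl⟩,
      ⟨O.secondHalf q, EventuallyEq.rfl⟩⟩) p).1
  · simp [blockSet, GoodGrid.ChildOrder.whole]
  · obtain ⟨A, hA⟩ := hA
    refine ⟨A, hA.trans ?_⟩
    have : blockSet [Q] = Q := by simp [blockSet]
    rw [this]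
    exact (O.ae_blockSet_children hQ).symm

variable [IsProbabilityMeasure μ]

namespace GoodGrid.ChildOrder.IsDipoleChoice

variable {x : O.family → G.Point}

theorem seq_firstHalf (hx : O.IsDipoleChoice x) (p : HaarPair O) :
    (x (O.firstHalf p)).seq (p.level + 1) ∈ p.fst :=
  ((x _).isIn_blockSet_iff fun _ hR => (p.mem_cells (List.mem_append_left _ hR)).1).1 (hx.isIn _)

theorem seq_secondHalf (hx : O.IsDipoleChoice x) (p : HaarPair O) :
    (x (O.secondHalf p)).seq (p.level + 1) ∈ p.snd :=
  ((x _).isIn_blockSet_iff fun _ hR => (p.mem_cells (List.mem_append_right _ hR)).1).1 (hx.isIn _)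

theorem seq_level_firstHalf (hx : O.IsDipoleChoice x) (p : HaarPair O) :
    (x (O.firstHalf p)).seq p.level = p.cell :=
  GoodGrid.Point.seq_level (p.mem_cells (List.mem_append_left _ (hx.seq_firstHalf p))).2

theorem seq_level_secondHalf (hx : O.IsDipoleChoice x) (p : HaarPair O) :
    (x (O.secondHalf p)).seq p.level = p.cell :=
  GoodGrid.Point.seq_level (p.mem_cells (List.mem_append_right _ (hx.seq_secondHalf p))).2

theorem firstHalf_ne_secondHalf (hx : O.IsDipoleChoice x) (p : HaarPair O) :
    x (O.firstHalf p) ≠ x (O.secondHalf p) := by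
  intro h
  have h1 := hx.seq_firstHalf p
  rw [h] at h1
  exact List.disjoint_of_nodup_append p.nodup_append h1 (hx.seq_secondHalf p)

/-- One half of every block contains no point that is chosen for a larger set. -/
theorem exists_new_half (hx : O.IsDipoleChoice x) (p : HaarPair O) :
    ∃ S : List (Set Ω), (S = p.fst ∨ S = p.snd) ∧
      ∀ B : O.family, blockSet (p.fst ++ p.snd) ≤ᵐ[μ] B.1 → (x B).seq (p.level + 1) ∉ S := by
  -- The point chosen for the block itself determines which half is old.
  obtain ⟨A, hA⟩ := p.exists_family
  have hmem : (x A).seq (p.level + 1) ∈ p.fst ++ p.snd :=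
    ((x A).isIn_blockSet_iff fun _ hR => (p.mem_cells hR).1).1 ((hx.isIn A).mono hA.le)
  have hS : ∃ S : List (Set Ω), (S = p.fst ∨ S = p.snd) ∧ (x A).seq (p.level + 1) ∉ S := by
    rcases List.mem_append.1 hmem with h | h
    · exact ⟨p.snd, Or.inr rfl, List.disjoint_of_nodup_append p.nodup_append h⟩
    · exact ⟨p.fst, Or.inl rfl, fun h' => List.disjoint_of_nodup_append p.nodup_append h' h⟩
  obtain ⟨S, hS, hn⟩ := hS
  refine ⟨S, hS, fun B hB h => hn ?_⟩
  have hsub : S ⊆ p.fst ++ p.snd := by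
    rcases hS with rfl | rfl
    · exact List.subset_append_left _ _
    · exact List.subset_append_right _ _
  have hin : (x B).IsIn A.1 := (((x B).isIn_blockSet_iff fun _ hR =>
    (p.mem_cells (hsub hR)).1).2 h).mono ((blockSet_mono hsub).eventuallyLE.trans hA.symm.le)
  -- By (B), a point x_B in S would be x_A, which is not in S.
  rwa [hx.eq_of_isIn A B (hA.le.trans hB) hin]

/-- The new half of a block does not separate the points of any other dipole. -/
theorem mem_new_half (p q : HaarPair O) (hpq : p ≠ q) {S : List (Set Ω)}
    (hS : S = p.fst ∨ S = p.snd)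
    (hnew : ∀ B : O.family, blockSet (p.fst ++ p.snd) ≤ᵐ[μ] B.1 →
      (x B).seq (p.level + 1) ∉ S) {T T' : List (Set Ω)}
    (hT : (T = q.fst ∧ T' = q.snd) ∨ (T = q.snd ∧ T' = q.fst)) {B B' : O.family}
    (hB : B.1 = blockSet T) (hyT : (x B).seq (q.level + 1) ∈ T)
    (hyT' : (x B').seq (q.level + 1) ∈ T') (h : (x B).seq (p.level + 1) ∈ S) :
    (x B').seq (p.level + 1) ∈ S := by
  have hTq : T ⊆ q.fst ++ q.snd ∧ T' ⊆ q.fst ++ q.snd := by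
    rcases hT with ⟨rfl, rfl⟩ | ⟨rfl, rfl⟩ <;> simp
  have hSp : S ⊆ p.fst ++ p.snd := by
    rcases hS with rfl | rfl <;> simp
  have hdp := List.disjoint_of_nodup_append p.nodup_append
  have hdq := List.disjoint_of_nodup_append q.nodup_append
  have hq : (x B).seq q.level = q.cell :=
    GoodGrid.Point.seq_level (q.mem_cells (hTq.1 hyT)).2
  have hq' : (x B').seq q.level = q.cell :=
    GoodGrid.Point.seq_level (q.mem_cells (hTq.2 hyT')).2
  have hp : (x B).seq p.level = p.cell :=
    GoodGrid.Point.seq_level (p.mem_cells (hSp h)).2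
  rcases lt_trichotomy q.level p.level with hl | hl | hl
  -- Here q is coarser: the branch of x_B passes through `p.cell`, so all of `p.cell` lies in one
  -- cell of T, hence in B. Newness then excludes x_B from S.
  · refine absurd h (hnew B ?_)
    rw [hB]
    refine p.blockSet_le_cell.trans ?_
    rw [← hp]
    refine ((x B).seq_le (Nat.succ_le_of_lt hl)).trans (ae_of_all _ fun ω hω => ?_)
    exact mem_iUnion₂.2 ⟨_, hyT, hω⟩
  -- At equal levels both cells are the cell of x_B, so the two pairs come from the same list of
  -- children.
  · have hc : p.cell = q.cell := by rw [← hp, ← hq, hl]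
    have hqp := q.isHaarPair
    rw [hl, ← hc] at hqp
    rw [hl] at hyT hyT'
    -- If the block of p lies in T, then B contains it, and x_B ∈ S contradicts newness.
    have hsub : p.fst ++ p.snd ⊆ T → (x B').seq (p.level + 1) ∈ S := fun h' =>
      absurd h (hnew B (by rw [hB]; exact (blockSet_mono h').eventuallyLE))
    rcases p.isHaarPair.dichotomy (O.nodup _ _ p.cell_mem) hqp with h1 | h1 | h1 | h1 | h1 | h1
    · exfalso
      apply hpq
      cases p
      cases q
      simp_all
    · rcases hS with rfl | rfl
      · exact h1 (hTq.2 hyT')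
      · exact absurd h (hdp (h1 (hTq.1 hyT)))
    · rcases hS with rfl | rfl
      · exact absurd (h1 (hTq.1 hyT)) (hdp h)
      · exact h1 (hTq.2 hyT')
    · rcases hT with ⟨rfl, rfl⟩ | ⟨rfl, rfl⟩
      · exact hsub h1
      · exact absurd hyT (hdq (h1 (hSp h)))
    · rcases hT with ⟨rfl, rfl⟩ | ⟨rfl, rfl⟩
      · exact absurd (h1 (hSp h)) (hdq hyT)
      · exact hsub h1
    · exact absurd (hTq.1 hyT) (h1 (hSp h))
  -- Here q is finer: both points lie in `q.cell`, so their branches agree up to its level, in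
  -- particular at level `p.level + 1`.
  · rwa [← GoodGrid.Point.seq_eq_of_le (Nat.succ_le_of_lt hl) (hq.trans hq'.symm)]

theorem mem_new_half_iff (hx : O.IsDipoleChoice x) (p q : HaarPair O) (hpq : p ≠ q)
    {S : List (Set Ω)} (hS : S = p.fst ∨ S = p.snd)
    (hnew : ∀ B : O.family, blockSet (p.fst ++ p.snd) ≤ᵐ[μ] B.1 →
      (x B).seq (p.level + 1) ∉ S) :
    (x (O.firstHalf q)).seq (p.level + 1) ∈ S ↔ (x (O.secondHalf q)).seq (p.level + 1) ∈ S :=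
  ⟨mem_new_half p q hpq hS hnew (Or.inl ⟨rfl, rfl⟩) rfl (hx.seq_firstHalf q)
    (hx.seq_secondHalf q),
  mem_new_half p q hpq hS hnew (Or.inr ⟨rfl, rfl⟩) rfl (hx.seq_secondHalf q)
    (hx.seq_firstHalf q)⟩

/-- The family of a Dirac mass and of the dipoles that belongs to a choice of points. -/
noncomputable def dipole {s : ℝ} (hs : 0 < s) (x : O.family → G.Point) :
    Option (HaarPair O) → BesovNeg O s
  | none => diracMass O hs (x O.whole)
  | some p => diracMass O hs (x (O.firstHalf p)) - diracMass O hs (x (O.secondHalf p))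

/-- The two points share the cell of p, so all Haar coefficients of lower level cancel. The factor 2
accounts for the two branches that start at this cell. -/
theorem enorm_dipole_le {s : ℝ} (hs : 0 < s) (hx : O.IsDipoleChoice x) (p : HaarPair O) :
    ‖dipole hs x (some p)‖ₑ ≤ 2 * haarConst G s * ENNReal.ofReal (μ.real p.cell ^ s) := by
  have h := enorm_diracMass_sub_le (O := O) hs (n := p.level)
    ((hx.seq_level_firstHalf p).trans (hx.seq_level_secondHalf p).symm)
  rwa [hx.seq_level_firstHalf p, ← mul_assoc] at h

/-- The dipoles that belong to a choice of points are an unconditional basis. -/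
theorem exists_basis {s : ℝ} (hs : 0 < s) (hx : O.IsDipoleChoice x) :
    ∃ b : UnconditionalSchauderBasis (Option (HaarPair O)) ℂ (BesovNeg O s),
      b.basis = dipole hs x := by
  classical
  choose S hS hnew using hx.exists_new_half
  have hblock : ∀ p : HaarPair O, ∃ ψ : BesovPos O s, ψ.IsBlock (S p) := by
    intro p
    obtain ⟨h1, h2⟩ := BesovPos.exists_isBlock s p
    rcases hS p with h | h <;> rwa [h]
  choose ψ hψ using hblock
  have hψ' : ∀ p, (ψ p).IsBlock p.fst ∨ (ψ p).IsBlock p.snd := fun p =>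
    (hS p).imp (fun h => by rw [← h]; exact hψ p) fun h => by rw [← h]; exact hψ p
  have hSsub : ∀ p, S p ⊆ p.fst ++ p.snd := by
    intro p
    rcases hS p with h | h <;> simp [h]
  have hSnd : ∀ p, (S p).Nodup := by
    intro p
    have hnd := List.nodup_append.1 p.nodup_append
    rcases hS p with h | h <;> rw [h]
    exacts [hnd.1, hnd.2.1]
  have heval : ∀ (p : HaarPair O) (y : G.Point), BesovNeg.eval (ψ p) (diracMass O hs y) =
      if y.seq (p.level + 1) ∈ S p then 1 else 0 := fun p y =>
    eval_diracMass hs y (hψ p) (hSnd p) fun R hR => (p.mem_cells (hSsub p hR)).1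
  have hone : ∀ y : G.Point, BesovNeg.eval (BesovPos.one O s) (diracMass O hs y) = 1 := by
    intro y
    rw [BesovNeg.eval_one]
    exact (BesovNeg.coeff_ofCoeff _ _ _).1
  -- The dipole takes the value 1 at the indicator of the first half and -1 at that of the second
  -- one; the sign corrects this.
  let ε : HaarPair O → ℂ := fun p => if S p = p.fst then 1 else -1
  have hε : ∀ p, ‖ε p‖ₑ = 1 := by
    intro p
    by_cases h : S p = p.fst <;> simp [ε, h]
  let f : Option (HaarPair O) → StrongDual ℂ (BesovNeg O s) := fun i =>
    i.elim (BesovNeg.eval (BesovPos.one O s)) fun p => ε p • BesovNeg.eval (ψ p)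
  have hortho : ∀ i j, f i (dipole hs x j) = (Pi.single j (1 : ℂ) : Option (HaarPair O) → ℂ) i := by
    rintro (_ | p) (_ | q)
    · simp [f, dipole, hone]
    · simp [f, dipole, hone]
    -- The whole space contains every block, so x_I lies in no new half.
    · have h := hnew p O.whole (ae_of_all _ fun _ _ => trivial)
      simp [f, dipole, heval, h]
    · by_cases hpq : p = q
      · subst hpq
        have h1 := hx.seq_firstHalf p
        have h2 := hx.seq_secondHalf p
        have hd := List.disjoint_of_nodup_append p.nodup_append
        have h3 : (x (O.secondHalf p)).seq (p.level + 1) ∉ p.fst := fun h' => hd h' h2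
        have h4 : (x (O.firstHalf p)).seq (p.level + 1) ∉ p.snd := hd h1
        have hne : p.snd ≠ p.fst := fun h => hd h1 (h ▸ h1)
        rcases hS p with h | h
        · simp [f, dipole, heval, ε, h, h1, h3]
        · simp [f, dipole, heval, ε, h, h2, h4, hne]
      · have h := hx.mem_new_half_iff p q hpq (hS p) (hnew p)
        simp [f, dipole, heval, h, hpq]
  refine ⟨⟨dipole hs x, f, fun i j => by convert hortho i j; rfl, fun φ => ?_⟩, rfl⟩
  -- Absolute convergence: the weights |Q_p|^s in the summability of the block values are the bounds
  -- for the dipole norms.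
  have hsum : Summable fun p : HaarPair O => f (some p) φ • dipole hs x (some p) := by
    refine Summable.of_norm (summable_norm_of_tsum_enorm_ne_top ?_)
    refine ne_top_of_le_ne_top (ENNReal.mul_ne_top (ENNReal.mul_ne_top
      (by simp : (2 : ℝ≥0∞) ≠ ∞) (haarConst_ne_top G hs))
      (tsum_enorm_eval_block_ne_top hs φ hψ')) ?_
    rw [← ENNReal.tsum_mul_left]
    refine ENNReal.tsum_le_tsum fun p => ?_
    have h1 : ‖f (some p) φ‖ₑ = ‖BesovNeg.eval (ψ p) φ‖ₑ := by
      change ‖ε p * BesovNeg.eval (ψ p) φ‖ₑ = _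
      rw [enorm_mul, hε, one_mul]
    rw [enorm_smul, h1, mul_comm, ← mul_assoc]
    exact mul_le_mul_left (enorm_dipole_le hs hx p) _
  obtain ⟨σ, hσ⟩ : ∃ σ, HasSum (fun i => f i φ • dipole hs x i) σ := ⟨_, hsum.hasSum.option⟩
  -- Biorthogonality and continuity of `f j` show that σ has the same coordinates as φ.
  have hcoord : ∀ j, f j (φ - σ) = 0 := by
    intro j
    have h1 := hσ.mapL (f j)
    have h2 := hasSum_single (f := fun i => f j (f i φ • dipole hs x i)) j fun i hij => by
      rw [map_smul, hortho, Pi.single_eq_of_ne hij.symm, smul_zero]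
    rw [map_sub, h1.unique h2, map_smul, hortho, Pi.single_eq_same, smul_eq_mul, mul_one, sub_self]
  have hzero : φ - σ = 0 := by
    -- The coordinates are values at 1 and, up to sign, at one half of every block, which is all
    -- that the descent requires.
    refine BesovNeg.eq_zero_of_eval_half (hcoord none) fun p => ⟨ψ p, hψ' p, ?_⟩
    have h1 : ε p * BesovNeg.eval (ψ p) (φ - σ) = 0 := hcoord (some p)
    refine (mul_eq_zero.1 h1).resolve_left fun h => ?_
    have := hε p
    rw [h] at this
    simp at this
  rwa [← sub_eq_zero.1 hzero] at hσ

end GoodGrid.ChildOrder.IsDipoleChoice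

end

/-- The Dirac masses exist in `B^{-s}_{1,1}`, there are dipole bases, and every dipole basis is an
unconditional Schauder basis of `B^{-s}_{1,1}` made of one Dirac mass and of dipoles. -/
theorem theorem5 {Ω : Type*} [MeasurableSpace Ω] (μ : Measure Ω) [IsProbabilityMeasure μ]
    (G : GoodGrid μ) (O : G.ChildOrder) (s : ℝ) (hs : 0 < s) :
    ∃ δ : G.Point → BesovNeg O s, (∀ x, IsDiracMass O s x (δ x)) ∧
      (∃ x : O.family → G.Point, O.IsDipoleChoice x) ∧
      ∀ x : O.family → G.Point, O.IsDipoleChoice x →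
        (∀ p : HaarPair O, x (O.firstHalf p) ≠ x (O.secondHalf p)) ∧
        ∃ b : UnconditionalSchauderBasis (Option (HaarPair O)) ℂ (BesovNeg O s),
          b none = δ (x O.whole) ∧
          ∀ p : HaarPair O, b (some p) = δ (x (O.firstHalf p)) - δ (x (O.secondHalf p)) := by
  refine ⟨diracMass O hs, isDiracMass_diracMass hs, O.exists_isDipoleChoice, fun x hx =>
    ⟨hx.firstHalf_ne_secondHalf, ?_⟩⟩
  obtain ⟨b, hb⟩ := hx.exists_basis hs
  exact ⟨b, congrFun hb none, fun p => congrFun hb (some p)⟩
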